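/- Let $P>0$ and $\sigma^2>0$. Consider the channel with real input $X$ and output $Y\in\{1,-1\}$, where $Y=1$ if $X+Z\in\mathcal D$ and $Y=-1$ otherwise; here $Z$ is Gaussian with mean $0$ and variance $\sigma^2$, independent of $X$, and the quantization region $\mathcal D\subset\mathbb R$ is a Borel set. For a fixed $\mathcal D$ let $C_{\mathcal D}(P)=\sup I(X;Y)$, where $I$ is mutual information and the supremum is over all laws of $X$ on $\mathbb R$ with $\mathsf E[X^2]\le P$, and let $C(P)=\sup_{\mathcal D}C_{\mathcal D}(P)$, the supremum being over all Borel sets $\mathcal D\subset\mathbb R$, be the capacity of the channel under the average-power constraint $P$. A region $\mathcal D$ is called capacity-achieving if $C_{\mathcal D}(P)=C(P)$. Then a threshold quantizer is optimal: there is a real number $\Upsilon=\Upsilon(P,\sigma^2)$, determined by $P$ and $\sigma^2$ only, such that $\{y\in\mathbb R: y\ge\Upsilon\}$ is capacity-achieving. Moreover, every capacity-achieving Borel region is of threshold form: up to a set of Lebesgue measure zero, it or its complement equals $\{y\in\mathbb R: y\ge t\}$ for some $t\in\mathbb R$. -/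

import Mathlib

open MeasureTheory ProbabilityTheory
open scoped ENNReal NNReal symmDiff

namespace OneBit

open Classical in
/-- The one-bit quantizer with quantization region `D`: it produces `1` on `D` and `-1` off `D`. -/
noncomputable def quantize (D : Set ℝ) (y : ℝ) : ℤ :=
  if y ∈ D then 1 else -1

/-- The joint law of the channel input and the quantized output, i.e. of `(X, quantize D (X + Z))`
where `X` has law `μ` and `Z` is independent of `X` and centered Gaussian of variance `v`. -/
noncomputable def jointLaw (v : ℝ≥0) (D : Set ℝ) (μ : Measure ℝ) : Measure (ℝ × ℤ) :=
  (μ.prod (gaussianReal 0 v)).map (fun p => (p.1, quantize D (p.1 + p.2)))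

/-- The mutual information (in nats) between the channel input and the quantized output: the
relative entropy of the joint law with respect to the product of its two marginals. -/
noncomputable def mutualInfo (v : ℝ≥0) (D : Set ℝ) (μ : Measure ℝ) : ℝ≥0∞ :=
  InformationTheory.klDiv (jointLaw v D μ) ((jointLaw v D μ).fst.prod (jointLaw v D μ).snd)

/-- Admissible input laws: probability measures on `ℝ` with second moment at most `P`. -/
def Admissible (P : ℝ) (μ : Measure ℝ) : Prop :=
  IsProbabilityMeasure μ ∧ ∫⁻ x, ENNReal.ofReal (x ^ 2) ∂μ ≤ ENNReal.ofReal P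

/-- The capacity under the average-power constraint `P` when the quantization region is `D`. -/
noncomputable def capacityOfRegion (P : ℝ) (v : ℝ≥0) (D : Set ℝ) : ℝ≥0∞ :=
  ⨆ (μ : Measure ℝ) (_ : Admissible P μ), mutualInfo v D μ

/-- The capacity under the average-power constraint `P`: the supremum of the mutual information
over all Borel quantization regions and all admissible input laws. -/
noncomputable def capacity (P : ℝ) (v : ℝ≥0) : ℝ≥0∞ :=
  ⨆ (D : Set ℝ) (_ : MeasurableSet D), capacityOfRegion P v D

/-- The Borel region `D` is optimal: no Borel region gives a larger capacity. -/
def IsCapacityAchieving (P : ℝ) (v : ℝ≥0) (D : Set ℝ) : Prop :=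
  MeasurableSet D ∧ capacityOfRegion P v D = capacity P v

end OneBit

/-! For a fixed input, mutual information is convex in the channel, so it lies above its tangent at
the channel of `D` (`info_tangent_le`). The linear term of that tangent is the integral over the
region of a combination of Gaussian densities, centred at the input points and weighted by log-odds.
Replacing `D` by the set `T` where this combination is positive cannot lose information, and gains
strictly unless `D` equals `T` almost everywhere (`exists_better_region`).

Three input points suffice, by a Carathéodory argument (`Feasible.exists_three`). After removal of a
positive factor, the combination is then a sum of three exponentials, so `T` or its complement is
convex (`convex_expSum_pos`): up to null sets and complements, `T` is a ray or a bounded interval.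
For an interval, the input points are reflected about its midpoint towards the origin. This
preserves the channel values, does not raise the power, and puts all points where the channel is
monotone. The extreme log-odds then have opposite signs, and a second application of the tangent
argument yields a ray that is strictly better (`exists_threshold_info_gt_of_Icc`).

It remains to see that suprema are attained. Compactness gives this for a single region and for
thresholds in a bounded interval (`exists_isMax_info`), while distant thresholds carry little
information (`exists_info_Ici_lt`). General input laws are reached through simple functions
(`capacityOfRegion_le`), once relative entropy is written as a difference of entropies
(`mutualInfo_eq`). -/

namespace OneBit

open Real (log exp binEntropy)

/-! ### Finite inputs: convexity of mutual information in the channel. -/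

/-- The mutual information between a finitely supported input with weights `a` and a binary output
whose conditional probability of `1` given the `i`-th input is `u i`. -/
noncomputable def info {ι : Type*} [Fintype ι] (a u : ι → ℝ) : ℝ :=
  binEntropy (∑ i, a i * u i) - ∑ i, a i * binEntropy (u i)

lemma binEntropy_eq_logs (p : ℝ) :
    binEntropy p = -(p * log p) - (1 - p) * log (1 - p) := by
  simp [binEntropy, Real.log_inv]; ring

section Finite

variable {ι : Type*} [Fintype ι] {a u u' : ι → ℝ}

lemma sum_mul_mem_Ioo (ha : ∀ i, 0 ≤ a i) (ha1 : ∑ i, a i = 1)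
    (hu : ∀ i, u i ∈ Set.Ioo (0 : ℝ) 1) : ∑ i, a i * u i ∈ Set.Ioo (0 : ℝ) 1 := by
  obtain ⟨j, hj⟩ : ∃ j, 0 < a j := by
    by_contra! h
    have : ∑ i, a i ≤ 0 := Finset.sum_nonpos fun i _ => h i
    linarith
  refine ⟨Finset.sum_pos' (fun i _ => mul_nonneg (ha i) (hu i).1.le)
    ⟨j, Finset.mem_univ _, mul_pos hj (hu j).1⟩, ?_⟩
  rw [← ha1]
  exact Finset.sum_lt_sum (fun i _ => mul_le_of_le_one_right (ha i) (hu i).2.le)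
    ⟨j, Finset.mem_univ _, mul_lt_of_lt_one_right hj (hu j).2⟩

/-- The log-sum inequality. -/
lemma log_sum_le (ha : ∀ i, 0 ≤ a i) (hu : ∀ i, 0 < u i) (hu' : ∀ i, 0 ≤ u' i)
    (hq : 0 < ∑ i, a i * u i) :
    ∑ i, a i * (u' i * (log (u i) - log (∑ i, a i * u i))) ≤
      ∑ i, a i * (u' i * log (u' i)) - (∑ i, a i * u' i) * log (∑ i, a i * u' i) := by
  set q := ∑ i, a i * u i with hq_def
  set q' := ∑ i, a i * u' i with hq'_def
  have hnn : ∀ i, 0 ≤ a i * u' i := fun i => mul_nonneg (ha i) (hu' i)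
  have hq' : 0 ≤ q' := Finset.sum_nonneg fun i _ => hnn i
  rcases hq'.eq_or_lt with h0 | hpos
  · have hz : ∀ i, a i * u' i = 0 := fun i =>
      (Finset.sum_eq_zero_iff_of_nonneg fun i _ => hnn i).1 h0.symm i (Finset.mem_univ i)
    simp_rw [← mul_assoc, hz, ← h0]
    simp
  have key : ∀ i, a i * (u' i - q' / q * u i) ≤
      a i * (u' i * log (u' i)) - a i * u' i * log q'
        - a i * (u' i * (log (u i) - log q)) := by
    intro i
    have : u' i - q' / q * u i ≤
        u' i * (log (u' i) - log q' - (log (u i) - log q)) := by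
      rcases (hu' i).eq_or_lt with h | h
      · rw [← h]
        have := mul_pos (div_pos hpos hq) (hu i)
        simp; linarith
      -- This is `log s ≤ s - 1` at the ratio of `u i / q` to `u' i / q'`. Weighted by `a i * u' i`
      -- and summed, the right-hand sides cancel because both families are normalised.
      · have h1 := Real.log_le_sub_one_of_pos (x := u i * q' / (u' i * q))
          (div_pos (mul_pos (hu i) hpos) (mul_pos h hq))
        rw [Real.log_div (mul_pos (hu i) hpos).ne' (mul_pos h hq).ne',
          Real.log_mul (hu i).ne' hpos.ne', Real.log_mul h.ne' hq.ne'] at h1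
        have h2 := mul_le_mul_of_nonneg_left h1 h.le
        have h3 : u' i * (u i * q' / (u' i * q) - 1) = q' / q * u i - u' i := by
          field_simp
        rw [h3] at h2
        linarith
    calc _ ≤ a i * (u' i * (log (u' i) - log q' - (log (u i) - log q))) :=
          mul_le_mul_of_nonneg_left this (ha i)
      _ = _ := by ring
  have hs := Finset.sum_le_sum fun i (_ : i ∈ Finset.univ) => key i
  have hl : ∑ i, a i * (u' i - q' / q * u i) = 0 := by
    have : ∀ i, a i * (u' i - q' / q * u i) = a i * u' i - q' / q * (a i * u i) := fun i => by ring
    simp_rw [this]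
    rw [Finset.sum_sub_distrib, ← Finset.mul_sum, ← hq_def, ← hq'_def,
      div_mul_cancel₀ _ hq.ne', sub_self]
  rw [hl, Finset.sum_sub_distrib, Finset.sum_sub_distrib, ← Finset.sum_mul, ← hq'_def] at hs
  linarith

/-- The difference of the log-odds of the `i`-th conditional probability and of the output. -/
noncomputable def logOdds (a u : ι → ℝ) (i : ι) : ℝ :=
  (log (u i) - log (∑ i, a i * u i)) - (log (1 - u i) - log (1 - ∑ i, a i * u i))

lemma sum_mul_one_sub (ha1 : ∑ i, a i = 1) :
    ∑ i, a i * (1 - u i) = 1 - ∑ i, a i * u i := by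
  simp_rw [mul_sub, mul_one]
  rw [Finset.sum_sub_distrib, ha1]

lemma info_eq_sum (ha1 : ∑ i, a i = 1) :
    info a u = ∑ i, a i * (u i * logOdds a u i)
      + ∑ i, a i * (log (1 - u i) - log (1 - ∑ i, a i * u i)) := by
  have h1 := sum_mul_one_sub (u := u) ha1
  unfold info logOdds
  set q := ∑ i, a i * u i with hq
  have : ∀ i, a i * (u i * ((log (u i) - log q) - (log (1 - u i) - log (1 - q))))
      + a i * (log (1 - u i) - log (1 - q)) =
      - (a i * binEntropy (u i)) - (a i * u i) * log q - (a i * (1 - u i)) * log (1 - q) := by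
    intro i; rw [binEntropy_eq_logs]; ring
  rw [← Finset.sum_add_distrib]
  simp_rw [this]
  rw [Finset.sum_sub_distrib, Finset.sum_sub_distrib, ← Finset.sum_mul, ← Finset.sum_mul, ← hq, h1,
    Finset.sum_neg_distrib, binEntropy_eq_logs]
  ring

/-- The mutual information is convex in the channel: it lies above its tangents. -/
lemma info_tangent_le (ha : ∀ i, 0 ≤ a i) (ha1 : ∑ i, a i = 1)
    (hu : ∀ i, u i ∈ Set.Ioo (0 : ℝ) 1) (hu' : ∀ i, u' i ∈ Set.Icc (0 : ℝ) 1) :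
    info a u + ∑ i, a i * logOdds a u i * (u' i - u i) ≤ info a u' := by
  have hq := sum_mul_mem_Ioo ha ha1 hu
  -- The log-sum inequality is used once for each output symbol. The gradient of `info a` at `u` has
  -- components `a i * logOdds a u i`.
  have h1 := log_sum_le ha (fun i => (hu i).1) (fun i => (hu' i).1) hq.1
  have h2 := log_sum_le (u := fun i => 1 - u i) (u' := fun i => 1 - u' i) ha
    (fun i => sub_pos.2 (hu i).2) (fun i => sub_nonneg.2 (hu' i).2)
    (by rw [sum_mul_one_sub ha1]; exact sub_pos.2 hq.2)
  rw [sum_mul_one_sub ha1, sum_mul_one_sub ha1] at h2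
  rw [info_eq_sum ha1]
  have h3 : info a u' = (∑ i, a i * (u' i * log (u' i))
        - (∑ i, a i * u' i) * log (∑ i, a i * u' i))
      + (∑ i, a i * ((1 - u' i) * log (1 - u' i))
        - (1 - ∑ i, a i * u' i) * log (1 - ∑ i, a i * u' i)) := by
    unfold info
    have : ∀ i, a i * binEntropy (u' i) =
      -(a i * (u' i * log (u' i))) - a i * ((1 - u' i) * log (1 - u' i)) := by
      intro i; rw [binEntropy_eq_logs]; ring
    simp_rw [this]
    rw [Finset.sum_sub_distrib, Finset.sum_neg_distrib, binEntropy_eq_logs]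
    ring
  rw [h3]
  refine le_trans (le_of_eq ?_) (add_le_add h1 h2)
  rw [← Finset.sum_add_distrib, ← Finset.sum_add_distrib, ← Finset.sum_add_distrib]
  refine Finset.sum_congr rfl fun i _ => ?_
  unfold logOdds
  ring

/-- This is the tangent inequality evaluated at the zero channel, which carries no information. It
shows that the linear term cannot vanish at a channel of positive information. -/
lemma info_le_sum_logOdds (ha : ∀ i, 0 ≤ a i) (ha1 : ∑ i, a i = 1)
    (hu : ∀ i, u i ∈ Set.Ioo (0 : ℝ) 1) :
    info a u ≤ ∑ i, a i * logOdds a u i * u i := by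
  have hq := sum_mul_mem_Ioo ha ha1 hu
  have h2 := log_sum_le (u := fun i => 1 - u i) (u' := fun _ => 1) ha
    (fun i => sub_pos.2 (hu i).2) (fun i => zero_le_one)
    (by rw [sum_mul_one_sub ha1]; exact sub_pos.2 hq.2)
  rw [sum_mul_one_sub ha1] at h2
  simp [ha1] at h2
  rw [info_eq_sum ha1]
  have : ∀ i, a i * (u i * logOdds a u i) = a i * logOdds a u i * u i := fun i => by ring
  simp_rw [this]
  simp only [mul_sub] at h2 ⊢
  linarith

lemma info_le_binEntropy (ha : ∀ i, 0 ≤ a i) (hu : ∀ i, u i ∈ Set.Icc (0 : ℝ) 1) :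
    info a u ≤ binEntropy (∑ i, a i * u i) := by
  unfold info
  have : 0 ≤ ∑ i, a i * binEntropy (u i) :=
    Finset.sum_nonneg fun i _ => mul_nonneg (ha i) (Real.binEntropy_nonneg (hu i).1 (hu i).2)
  linarith

lemma info_one_sub (ha1 : ∑ i, a i = 1) : info a (fun i => 1 - u i) = info a u := by
  unfold info
  rw [sum_mul_one_sub ha1]
  simp

lemma info_const (ha1 : ∑ i, a i = 1) (c : ℝ) : info a (fun _ => c) = 0 := by
  simp [info, ← Finset.sum_mul, ha1]

/-- The output probability is an average of the `u i`, hence at most the largest of them, and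
log-odds increase with the probability. This fixes the signs of the extreme coefficients when the
channel is monotone. -/
lemma logOdds_nonneg (ha : ∀ i, 0 ≤ a i) (ha1 : ∑ i, a i = 1)
    (hu : ∀ i, u i ∈ Set.Ioo (0 : ℝ) 1) {j : ι} (hj : ∀ i, u i ≤ u j) : 0 ≤ logOdds a u j := by
  have hq := sum_mul_mem_Ioo ha ha1 hu
  have hle : ∑ i, a i * u i ≤ u j := by
    calc _ ≤ ∑ i, a i * u j :=
          Finset.sum_le_sum fun i _ => mul_le_mul_of_nonneg_left (hj i) (ha i)
      _ = u j := by rw [← Finset.sum_mul, ha1, one_mul]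
  unfold logOdds
  have h1 := Real.log_le_log hq.1 hle
  have h2 := Real.log_le_log (sub_pos.2 (hu j).2) (sub_le_sub_left hle 1)
  linarith

lemma logOdds_nonpos (ha : ∀ i, 0 ≤ a i) (ha1 : ∑ i, a i = 1)
    (hu : ∀ i, u i ∈ Set.Ioo (0 : ℝ) 1) {j : ι} (hj : ∀ i, u j ≤ u i) : logOdds a u j ≤ 0 := by
  have hq := sum_mul_mem_Ioo ha ha1 hu
  have hle : u j ≤ ∑ i, a i * u i := by
    calc u j = ∑ i, a i * u j := by rw [← Finset.sum_mul, ha1, one_mul]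
      _ ≤ _ := Finset.sum_le_sum fun i _ => mul_le_mul_of_nonneg_left (hj i) (ha i)
  unfold logOdds
  have h1 := Real.log_le_log (hu j).1 hle
  have h2 := Real.log_le_log (sub_pos.2 hq.2) (sub_le_sub_left hle 1)
  linarith

end Finite

/-! ### Reduction to three mass points. -/

/-- The input that takes the value `x i` with probability `a i` has average power at most `P`. -/
structure Feasible {ι : Type*} [Fintype ι] (P : ℝ) (a x : ι → ℝ) : Prop where
  nonneg : ∀ i, 0 ≤ a i
  sum_eq : ∑ i, a i = 1
  power : ∑ i, a i * x i ^ 2 ≤ P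

/-- More than three points are never needed: one of them can be removed. -/
lemma Feasible.exists_drop {P : ℝ} {n : ℕ} {a x : Fin (n + 4) → ℝ} (h : Feasible P a x)
    (p : ℝ → ℝ) : ∃ b y : Fin (n + 3) → ℝ, Feasible P b y ∧
      info a (p ∘ x) ≤ info b (p ∘ y) := by
  -- At least four vectors in a three-dimensional space are dependent. Moving the weights along `c`
  -- preserves mass, output probability and power; the sign of `c` is free and is chosen so that the
  -- conditional entropy does not increase.
  obtain ⟨c, hc0, hcp, hcx, hch, j, hj⟩ : ∃ c : Fin (n + 4) → ℝ, ∑ i, c i = 0 ∧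
      ∑ i, c i * p (x i) = 0 ∧ ∑ i, c i * x i ^ 2 = 0 ∧
      ∑ i, c i * binEntropy (p (x i)) ≤ 0 ∧ ∃ j, c j ≠ 0 := by
    have hli : ¬ LinearIndependent ℝ
        (fun i : Fin (n + 4) => (![1, p (x i), x i ^ 2] : Fin 3 → ℝ)) := by
      intro hli
      have := hli.fintype_card_le_finrank
      simp at this
    obtain ⟨c, hc, j, hj⟩ := Fintype.not_linearIndependent_iff.1 hli
    have h0 := congrFun hc 0
    have h1 := congrFun hc 1
    have h2 := congrFun hc 2
    simp [Finset.sum_apply] at h0 h1 h2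
    rcases le_total (∑ i, c i * binEntropy (p (x i))) 0 with hs | hs
    · exact ⟨c, h0, h1, h2, hs, j, hj⟩
    · exact ⟨fun i => -c i, by simp [h0], by simp [h1], by simp [h2], by simpa using hs, j,
        by simpa using hj⟩
  obtain ⟨k, hk⟩ : ∃ k, c k < 0 := by
    by_contra! hn
    exact hj ((Finset.sum_eq_zero_iff_of_nonneg fun i _ => hn i).1 hc0 j (Finset.mem_univ j))
  obtain ⟨m, hm, hmin⟩ := Finset.exists_min_image (Finset.univ.filter fun i => c i < 0)
    (fun i => a i / (-c i)) ⟨k, by simp [hk]⟩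
  simp only [Finset.mem_filter, Finset.mem_univ, true_and] at hm hmin
  -- The longest step that keeps all weights nonnegative; it brings the weight of `m` to zero.
  set τ := a m / (-c m) with hτ
  have hτ0 : 0 ≤ τ := div_nonneg (h.nonneg m) (by linarith)
  set b : Fin (n + 4) → ℝ := fun i => a i + τ * c i with hb
  have hb0 : ∀ i, 0 ≤ b i := by
    intro i
    rcases lt_or_ge (c i) 0 with hi | hi
    · have := hmin i hi
      rw [le_div_iff₀ (by linarith)] at this
      simp only [hb]; linarith
    · have := mul_nonneg hτ0 hi
      have := h.nonneg i
      simp only [hb]; linarith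
  have hbm : b m = 0 := by
    simp only [hb, hτ]
    have : c m ≠ 0 := hm.ne
    field_simp; ring
  have hsum : ∀ f : ℝ → ℝ, ∑ i, b (m.succAbove i) * f (x (m.succAbove i)) =
      ∑ i, a i * f (x i) + τ * ∑ i, c i * f (x i) := by
    intro f
    have h1 : ∑ i, b i * f (x i) = ∑ i, a i * f (x i) + τ * ∑ i, c i * f (x i) := by
      rw [Finset.mul_sum, ← Finset.sum_add_distrib]
      exact Finset.sum_congr rfl fun i _ => by simp only [hb]; ring
    rw [← h1, Fin.sum_univ_succAbove _ m, hbm]; simp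
  refine ⟨fun i => b (m.succAbove i), fun i => x (m.succAbove i),
    ⟨fun i => hb0 _, ?_, ?_⟩, ?_⟩
  · have := hsum fun _ => 1
    simpa [hc0, h.sum_eq] using this
  · have := hsum fun y => y ^ 2
    rw [this, hcx]
    simpa using h.power
  · have h1 := hsum p
    have h2 := hsum fun y => binEntropy (p y)
    have := mul_nonpos_of_nonneg_of_nonpos hτ0 hch
    simp only [info, Function.comp_apply, h1, h2, hcp]
    simp
    linarith

lemma Feasible.exists_three {P : ℝ} (p : ℝ → ℝ) {n : ℕ} {a x : Fin n → ℝ} (h : Feasible P a x) :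
    ∃ b y : Fin 3 → ℝ, Feasible P b y ∧ info a (p ∘ x) ≤ info b (p ∘ y) := by
  have main : ∀ n : ℕ, ∀ a x : Fin (n + 3) → ℝ, Feasible P a x →
      ∃ b y : Fin 3 → ℝ, Feasible P b y ∧ info a (p ∘ x) ≤ info b (p ∘ y) := by
    intro n
    induction n with
    | zero => exact fun a x h => ⟨a, x, h, le_rfl⟩
    | succ n ih =>
      intro a x h
      obtain ⟨b, y, hb, hle⟩ := h.exists_drop p
      obtain ⟨b', y', hb', hle'⟩ := ih b y hb
      exact ⟨b', y', hb', hle.trans hle'⟩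
  -- Three atoms of weight zero at the origin are appended, so that the number of points has the
  -- form `n + 3` even if it was below three.
  have hs : ∀ f : ℝ → ℝ, ∑ i, Fin.append a (fun _ : Fin 3 => 0) i *
      f (Fin.append x (fun _ : Fin 3 => 0) i) = ∑ i, a i * f (x i) := by
    intro f
    rw [Fin.sum_univ_add]
    simp
  obtain ⟨b, y, hb, hle⟩ := main n (Fin.append a fun _ => 0) (Fin.append x fun _ => 0)
    ⟨fun i => by
        refine Fin.addCases (fun j => ?_) (fun j => ?_) i
        · simpa using h.nonneg j
        · simp,
      by simpa [h.sum_eq] using hs fun _ => 1, by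
        have := hs fun y => y ^ 2
        rw [this]; exact h.power⟩
  refine ⟨b, y, hb, le_trans (le_of_eq ?_) hle⟩
  have h1 := hs p
  have h2 := hs fun y => binEntropy (p y)
  simp only [info, Function.comp_apply, h1, h2]

/-- The points of a feasible input can be listed in increasing order. -/
lemma Feasible.exists_sorted {P : ℝ} {n : ℕ} {a x : Fin n → ℝ} (h : Feasible P a x) :
    ∃ b y : Fin n → ℝ, Feasible P b y ∧ Monotone y ∧ (∀ i, ∃ j, y i = x j) ∧
      ∀ p : ℝ → ℝ, info b (p ∘ y) = info a (p ∘ x) := by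
  set σ := Tuple.sort x
  have hs : ∀ f : ℝ → ℝ, ∑ i, a (σ i) * f (x (σ i)) = ∑ i, a i * f (x i) := fun f =>
    Equiv.sum_comp σ fun i => a i * f (x i)
  refine ⟨a ∘ σ, x ∘ σ, ⟨fun i => h.nonneg _, ?_, ?_⟩, Tuple.monotone_sort x, fun i => ⟨σ i, rfl⟩,
    fun p => ?_⟩
  · simpa [h.sum_eq] using hs fun _ => 1
  · have := hs fun y => y ^ 2
    simp only [Function.comp_apply]
    rw [this]; exact h.power
  · have h1 := hs p
    have h2 := hs fun y => binEntropy (p y)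
    simp only [info, Function.comp_apply, h1, h2]

/-! ### The Gaussian channel: continuity, tails, and intervals. -/

/-- The probability that the channel output is `1` given that the input is `x`. -/
noncomputable def pr (v : ℝ≥0) (D : Set ℝ) (x : ℝ) : ℝ := (gaussianReal x v).real D

section Channel

variable {v : ℝ≥0} {D E : Set ℝ}

lemma pr_mem_Icc (x : ℝ) : pr v D x ∈ Set.Icc (0 : ℝ) 1 :=
  ⟨measureReal_nonneg, measureReal_le_one⟩

lemma pr_compl (hD : MeasurableSet D) (x : ℝ) : pr v Dᶜ x = 1 - pr v D x := by
  unfold pr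
  rw [probReal_compl_eq_one_sub hD]

lemma pr_congr (hv : v ≠ 0) (h : D =ᵐ[volume] E) : pr v D = pr v E := by
  funext x
  exact measureReal_congr ((gaussianReal_absolutelyContinuous x hv).ae_eq h)

lemma pr_empty : pr v ∅ = fun _ => 0 := by funext x; simp [pr]

lemma pr_univ : pr v Set.univ = fun _ => 1 := by funext x; simp [pr]

lemma pr_mem_Ioo (hv : v ≠ 0) (hD : MeasurableSet D) (h0 : ¬ D =ᵐ[volume] (∅ : Set ℝ))
    (h1 : ¬ D =ᵐ[volume] Set.univ) (x : ℝ) : pr v D x ∈ Set.Ioo (0 : ℝ) 1 := by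
  have hne : ∀ E : Set ℝ, ¬ E =ᵐ[volume] (∅ : Set ℝ) → 0 < pr v E x := by
    intro E hE
    refine lt_of_le_of_ne (pr_mem_Icc x).1 fun h => hE ?_
    have h' : (gaussianReal x v) E = 0 := by
      simpa [pr, measureReal_def, ENNReal.toReal_eq_zero_iff] using h.symm
    exact ae_eq_empty.2 (gaussianReal_absolutelyContinuous' x hv h')
  refine ⟨hne D h0, ?_⟩
  have := hne Dᶜ fun h => h1 (by simpa using h.compl)
  rw [pr_compl hD] at this
  linarith

lemma pr_eq_integral (hv : v ≠ 0) (x : ℝ) : pr v D x = ∫ y in D, gaussianPDFReal x v y := by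
  unfold pr
  rw [measureReal_def, gaussianReal_apply_eq_integral x hv, ENNReal.toReal_ofReal]
  exact integral_nonneg fun y => gaussianPDFReal_nonneg x v y

/-- An integrable bound, uniform for means within distance one of `x₀`, that makes dominated
convergence available in `continuous_pr`. It rests on `(y - x₀) ^ 2 ≤ 2 * (y - x) ^ 2 + 2`. -/
lemma gaussianPDFReal_le (hv : v ≠ 0) (x₀ : ℝ) {x : ℝ} (hx : |x - x₀| ≤ 1) (y : ℝ) :
    gaussianPDFReal x v y ≤
      (√(2 * Real.pi * v))⁻¹ * (exp (1 / (2 * v)) * exp (-(1 / (4 * v)) * (y - x₀) ^ 2)) := by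
  have hv' : (0 : ℝ) < v := NNReal.coe_pos.2 (pos_iff_ne_zero.2 hv)
  rw [gaussianPDFReal_def, ← Real.exp_add]
  refine mul_le_mul_of_nonneg_left (Real.exp_le_exp.2 ?_) (by positivity)
  have h1 : (x - x₀) ^ 2 ≤ 1 := by rw [← sq_abs]; nlinarith [abs_nonneg (x - x₀)]
  have h2 : (y - x₀) ^ 2 ≤ 2 * (y - x) ^ 2 + 2 := by nlinarith [sq_nonneg (y - x - (x - x₀))]
  have : 1 / (2 * (v : ℝ)) + -(1 / (4 * v)) * (y - x₀) ^ 2 - -(y - x) ^ 2 / (2 * v)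
      = (2 * (y - x) ^ 2 + 2 - (y - x₀) ^ 2) / (4 * v) := by field_simp; ring
  have : 0 ≤ (2 * (y - x) ^ 2 + 2 - (y - x₀) ^ 2) / (4 * (v : ℝ)) :=
    div_nonneg (by linarith) (by positivity)
  linarith

lemma continuous_pr (hv : v ≠ 0) (D : Set ℝ) : Continuous (pr v D) := by
  have hv' : (0 : ℝ) < v := NNReal.coe_pos.2 (pos_iff_ne_zero.2 hv)
  have : pr v D = fun x => ∫ y in D, gaussianPDFReal x v y := funext fun x => pr_eq_integral hv x
  rw [this]
  refine continuous_iff_continuousAt.2 fun x₀ => ?_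
  refine continuousAt_of_dominated
    (bound := fun y => (√(2 * Real.pi * v))⁻¹ *
      (exp (1 / (2 * v)) * exp (-(1 / (4 * v)) * (y - x₀) ^ 2))) ?_ ?_ ?_ ?_
  · exact Filter.Eventually.of_forall fun x =>
      (stronglyMeasurable_gaussianPDFReal x v).aestronglyMeasurable
  · filter_upwards [Metric.closedBall_mem_nhds x₀ one_pos] with x hx
    refine Filter.Eventually.of_forall fun y => ?_
    rw [Real.norm_of_nonneg (gaussianPDFReal_nonneg x v y)]
    exact gaussianPDFReal_le hv x₀ (by simpa [Real.dist_eq] using hx) y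
  · refine Integrable.const_mul (Integrable.const_mul ?_ _) _
    exact ((integrable_exp_neg_mul_sq (b := 1 / (4 * (v : ℝ))) (by positivity)).comp_sub_right
      x₀).integrableOn
  · refine Filter.Eventually.of_forall fun y => ?_
    unfold gaussianPDFReal
    fun_prop

lemma pr_translate (t x : ℝ) : pr v (Set.Ici t) x = pr v (Set.Ici 0) (x - t) := by
  unfold pr
  rw [← gaussianReal_map_sub_const (μ := x) (v := v) t, measureReal_def, measureReal_def,
    Measure.map_apply (by fun_prop) measurableSet_Ici]
  congr 2
  ext y; simp

lemma continuous_pr_Ici (hv : v ≠ 0) {S : Type*} [TopologicalSpace S] {f : S → ℝ}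
    (hf : Continuous f) : Continuous fun z : S × ℝ => pr v (Set.Ici (f z.1)) z.2 := by
  have : (fun z : S × ℝ => pr v (Set.Ici (f z.1)) z.2) =
      fun z => pr v (Set.Ici 0) (z.2 - f z.1) := funext fun z => pr_translate (f z.1) z.2
  rw [this]
  exact (continuous_pr hv _).comp (continuous_snd.sub (hf.comp continuous_fst))

lemma integral_sq_gaussianReal (x : ℝ) (v : ℝ≥0) :
    ∫ y, y ^ 2 ∂gaussianReal x v = x ^ 2 + v := by
  have h1 := variance_eq_sub (memLp_id_gaussianReal (μ := x) (v := v) 2)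
  rw [variance_id_gaussianReal] at h1
  simp [integral_id_gaussianReal] at h1
  linarith

/-- Chebyshev's inequality for the uncentred second moment. -/
lemma sq_mul_gaussianReal_le (x t : ℝ) {E : Set ℝ} (hE : ∀ y ∈ E, t ^ 2 ≤ y ^ 2) :
    t ^ 2 * (gaussianReal x v).real E ≤ x ^ 2 + v := by
  have hi : Integrable (fun y : ℝ => y ^ 2) (gaussianReal x v) :=
    (memLp_id_gaussianReal (μ := x) (v := v) 2).integrable_sq
  have h := mul_meas_ge_le_integral_of_nonneg
    (Filter.Eventually.of_forall fun y : ℝ => sq_nonneg y) hi (t ^ 2)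
  rw [integral_sq_gaussianReal] at h
  refine le_trans (mul_le_mul_of_nonneg_left ?_ (sq_nonneg t)) h
  exact measureReal_mono fun y hy => hE y hy

lemma pr_Icc_eq_intervalIntegral (hv : v ≠ 0) {a b : ℝ} (hab : a ≤ b) (x : ℝ) :
    pr v (Set.Icc a b) x = ∫ y in (a - x)..(b - x), gaussianPDFReal 0 v y := by
  rw [pr_eq_integral hv, integral_Icc_eq_integral_Ioc, ← intervalIntegral.integral_of_le hab,
    ← intervalIntegral.integral_comp_sub_right]
  refine intervalIntegral.integral_congr fun y _ => ?_
  simp [gaussianPDFReal]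

lemma gaussianPDFReal_zero_neg (y : ℝ) : gaussianPDFReal 0 v (-y) = gaussianPDFReal 0 v y := by
  simp [gaussianPDFReal]

lemma gaussianPDFReal_zero_le {y z : ℝ} (h : y ^ 2 ≤ z ^ 2) :
    gaussianPDFReal 0 v z ≤ gaussianPDFReal 0 v y := by
  unfold gaussianPDFReal
  refine mul_le_mul_of_nonneg_left (Real.exp_le_exp.2 ?_) (by positivity)
  simp only [sub_zero]
  exact div_le_div_of_nonneg_right (neg_le_neg h) (by positivity)

lemma pr_Icc_reflect (hv : v ≠ 0) {a b : ℝ} (hab : a ≤ b) (x : ℝ) :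
    pr v (Set.Icc a b) (a + b - x) = pr v (Set.Icc a b) x := by
  rw [pr_Icc_eq_intervalIntegral hv hab, pr_Icc_eq_intervalIntegral hv hab]
  have h := intervalIntegral.integral_comp_neg (a := a - x) (b := b - x)
    (fun y => gaussianPDFReal 0 v y)
  simp only [gaussianPDFReal_zero_neg] at h
  rw [h]
  congr 1 <;> ring

lemma pr_Icc_monotoneOn (hv : v ≠ 0) {a b : ℝ} (hab : a ≤ b) :
    MonotoneOn (pr v (Set.Icc a b)) (Set.Iic ((a + b) / 2)) := by
  intro x hx x' hx' hxx
  simp only [Set.mem_Iic] at hx hx'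
  rw [pr_Icc_eq_intervalIntegral hv hab, pr_Icc_eq_intervalIntegral hv hab]
  set f := gaussianPDFReal 0 v
  have hi : ∀ c d : ℝ, IntervalIntegrable f volume c d := fun c d =>
    (integrable_gaussianPDFReal 0 v).intervalIntegrable
  have h1 := intervalIntegral.integral_add_adjacent_intervals (hi (a - x') (a - x))
    (hi (a - x) (b - x))
  have h2 := intervalIntegral.integral_add_adjacent_intervals (hi (a - x') (b - x'))
    (hi (b - x') (b - x))
  -- Moving the mean from `x` to `x'` shifts the window of integration to the left. The piece lost
  -- is the translate by `b - a` of the piece gained, and each of its points is at least as far from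
  -- the origin.
  have h3 : ∫ y in (b - x')..(b - x), f y ≤ ∫ y in (a - x')..(a - x), f y := by
    have : ∫ y in (b - x')..(b - x), f y = ∫ y in (a - x')..(a - x), f (y + (b - a)) := by
      rw [intervalIntegral.integral_comp_add_right]
      congr 1 <;> ring
    rw [this]
    refine intervalIntegral.integral_mono_on (by linarith) ?_ (hi _ _) fun y hy => ?_
    · exact ((integrable_gaussianPDFReal 0 v).comp_add_right (b - a)).intervalIntegrable
    · refine gaussianPDFReal_zero_le ?_
      nlinarith [hy.1, mul_nonneg (sub_nonneg.2 hab) (by linarith [hy.1] : 0 ≤ 2 * y + (b - a))]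
  linarith

lemma pr_Icc_antitoneOn (hv : v ≠ 0) {a b : ℝ} (hab : a ≤ b) :
    AntitoneOn (pr v (Set.Icc a b)) (Set.Ici ((a + b) / 2)) := by
  intro x hx x' hx' hxx
  simp only [Set.mem_Ici] at hx hx'
  rw [← pr_Icc_reflect hv hab x, ← pr_Icc_reflect hv hab x']
  exact pr_Icc_monotoneOn hv hab (by simp only [Set.mem_Iic]; linarith)
    (by simp only [Set.mem_Iic]; linarith) (by linarith)

end Channel

/-! ### Sums of three exponentials: zeros and signs. -/

/-- The zeros of a nonzero analytic function form a discrete set, which is countable on the line. -/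
lemma volume_zeros_eq_zero {f : ℝ → ℝ} (hf : AnalyticOnNhd ℝ f Set.univ) {x : ℝ} (hx : f x ≠ 0) :
    volume {y | f y = 0} = 0 := by
  have h := (mem_codiscrete'.1 (hf.preimage_zero_mem_codiscrete hx)).2
  have h' : IsDiscrete {y | f y = 0} := by
    convert h using 1
    ext y; simp
  exact ((HereditarilyLindelofSpace.isLindelof _).countable_of_isDiscrete h').measure_zero _

section ExpSum

variable {c k : Fin 3 → ℝ}

/-- A linear combination of three exponentials. -/
noncomputable def expSum (c k : Fin 3 → ℝ) (y : ℝ) : ℝ := ∑ i, c i * exp (k i * y)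

lemma analyticOnNhd_expSum (c k : Fin 3 → ℝ) : AnalyticOnNhd ℝ (expSum c k) Set.univ := by
  intro y _
  unfold expSum
  fun_prop

lemma measurable_expSum (c k : Fin 3 → ℝ) : Measurable (expSum c k) := by
  unfold expSum
  fun_prop

/-- With the middle exponential divided out and `k` monotone, one remaining exponential is
nonincreasing and the other nondecreasing. The signs of `c 0` and `c 2` then make the quotient
monotone, convex or concave, whatever `c 1` is. -/
lemma expSum_pos_iff (y : ℝ) : 0 < expSum c k y ↔
    0 < c 0 * exp ((k 0 - k 1) * y) + c 1 + c 2 * exp ((k 2 - k 1) * y) := by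
  have : expSum c k y =
      exp (k 1 * y) * (c 0 * exp ((k 0 - k 1) * y) + c 1 + c 2 * exp ((k 2 - k 1) * y)) := by
    have h : ∀ m, exp (m * y) = exp (k 1 * y) * exp ((m - k 1) * y) := fun m => by
      rw [← Real.exp_add]; ring_nf
    rw [expSum, Fin.sum_univ_three, h (k 0), h (k 2)]
    ring
  rw [this]
  exact mul_pos_iff_of_pos_left (Real.exp_pos _)

lemma isUpperSet_expSum_pos (hk : Monotone k) (h0 : c 0 ≤ 0) (h2 : 0 ≤ c 2) :
    IsUpperSet {y | 0 < expSum c k y} := by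
  intro y z hyz hy
  simp only [Set.mem_ofPred_eq, expSum_pos_iff] at hy ⊢
  have hk0 : k 0 ≤ k 1 := hk (by decide)
  have hk2 : k 1 ≤ k 2 := hk (by decide)
  have e0 : exp ((k 0 - k 1) * z) ≤ exp ((k 0 - k 1) * y) := Real.exp_le_exp.2 (by nlinarith)
  have e2 : exp ((k 2 - k 1) * y) ≤ exp ((k 2 - k 1) * z) := Real.exp_le_exp.2 (by nlinarith)
  nlinarith [mul_le_mul_of_nonpos_left e0 h0, mul_le_mul_of_nonneg_left e2 h2]

lemma isLowerSet_expSum_pos (hk : Monotone k) (h0 : 0 ≤ c 0) (h2 : c 2 ≤ 0) :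
    IsLowerSet {y | 0 < expSum c k y} := by
  intro z y hyz hy
  simp only [Set.mem_ofPred_eq, expSum_pos_iff] at hy ⊢
  have hk0 : k 0 ≤ k 1 := hk (by decide)
  have hk2 : k 1 ≤ k 2 := hk (by decide)
  have e0 : exp ((k 0 - k 1) * z) ≤ exp ((k 0 - k 1) * y) := Real.exp_le_exp.2 (by nlinarith)
  have e2 : exp ((k 2 - k 1) * y) ≤ exp ((k 2 - k 1) * z) := Real.exp_le_exp.2 (by nlinarith)
  nlinarith [mul_le_mul_of_nonpos_left e2 h2, mul_le_mul_of_nonneg_left e0 h0]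

lemma exp_mul_convex_le (m y z : ℝ) {a b : ℝ} (ha : 0 ≤ a) (hb : 0 ≤ b) (hab : a + b = 1) :
    exp (m * (a * y + b * z)) ≤ a * exp (m * y) + b * exp (m * z) := by
  have h := convexOn_exp.2 (Set.mem_univ (m * y)) (Set.mem_univ (m * z)) ha hb hab
  simp only [smul_eq_mul] at h
  refine le_trans (le_of_eq ?_) h
  ring_nf

/-- A linear combination of three exponentials has at most two changes of sign. -/
lemma convex_expSum_pos (hk : Monotone k) :
    Convex ℝ {y | 0 < expSum c k y} ∨ Convex ℝ {y | 0 < expSum c k y}ᶜ := by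
  rcases le_total 0 (c 0) with h0 | h0 <;> rcases le_total 0 (c 2) with h2 | h2
  -- Both outer coefficients are nonnegative: the quotient is convex, so its nonpositivity set is
  -- convex.
  · right
    intro y hy z hz a b ha hb hab
    simp only [Set.mem_compl_iff, Set.mem_ofPred_eq, expSum_pos_iff, not_lt, smul_eq_mul]
      at hy hz ⊢
    have e0 := mul_le_mul_of_nonneg_left
      (exp_mul_convex_le (k 0 - k 1) y z ha hb hab) h0
    have e2 := mul_le_mul_of_nonneg_left
      (exp_mul_convex_le (k 2 - k 1) y z ha hb hab) h2
    have hc : c 1 = a * c 1 + b * c 1 := by rw [← add_mul, hab, one_mul]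
    linarith [mul_le_mul_of_nonneg_left hy ha, mul_le_mul_of_nonneg_left hz hb]
  · exact Or.inl (isLowerSet_expSum_pos hk h0 h2).ordConnected.convex
  · exact Or.inl (isUpperSet_expSum_pos hk h0 h2).ordConnected.convex
  -- Both outer coefficients are nonpositive: the quotient is concave, so its positivity set is
  -- convex.
  · left
    intro y hy z hz a b ha hb hab
    simp only [Set.mem_ofPred_eq, expSum_pos_iff, smul_eq_mul] at hy hz ⊢
    have e0 := mul_le_mul_of_nonpos_left
      (exp_mul_convex_le (k 0 - k 1) y z ha hb hab) h0
    have e2 := mul_le_mul_of_nonpos_left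
      (exp_mul_convex_le (k 2 - k 1) y z ha hb hab) h2
    have hc : c 1 = a * c 1 + b * c 1 := by rw [← add_mul, hab, one_mul]
    rcases ha.eq_or_lt with h | h
    · have hb1 : b = 1 := by linarith
      subst hb1; subst h
      simpa using hz
    · linarith [mul_pos h hy, mul_le_mul_of_nonneg_left hz.le hb]

end ExpSum

/-! ### Threshold sets and convex subsets of the line. -/

/-- Up to a null set, the region or its complement is `{y | t ≤ y}` for some `t`. -/
def IsThreshold (D : Set ℝ) : Prop :=
  ∃ t : ℝ, D =ᵐ[volume] Set.Ici t ∨ (Dᶜ : Set ℝ) =ᵐ[volume] Set.Ici t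

lemma IsThreshold.congr {D E : Set ℝ} (hD : IsThreshold D) (h : D =ᵐ[volume] E) :
    IsThreshold E := by
  obtain ⟨t, ht | ht⟩ := hD
  · exact ⟨t, Or.inl (h.symm.trans ht)⟩
  · exact ⟨t, Or.inr (h.symm.compl.trans ht)⟩

lemma IsThreshold.compl {D : Set ℝ} (hD : IsThreshold D) : IsThreshold Dᶜ := by
  obtain ⟨t, ht | ht⟩ := hD
  · exact ⟨t, Or.inr (by rwa [compl_compl])⟩
  · exact ⟨t, Or.inl ht⟩

lemma IsUpperSet.isThreshold {S : Set ℝ} (hS : IsUpperSet S) (h0 : S.Nonempty)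
    (h1 : S ≠ Set.univ) : IsThreshold S := by
  obtain ⟨z, hz⟩ := (Set.ne_univ_iff_exists_notMem S).1 h1
  have hb : BddBelow S := ⟨z, fun y hy => le_of_not_ge fun h => hz (hS h hy)⟩
  refine ⟨sInf S, Or.inl ?_⟩
  have hsub : S ⊆ Set.Ici (sInf S) := fun y hy => csInf_le hb hy
  have hsup : Set.Ioi (sInf S) ⊆ S := fun y hy => by
    obtain ⟨s, hs, hsy⟩ := exists_lt_of_csInf_lt h0 hy
    exact hS hsy.le hs
  exact (LE.le.eventuallyLE hsub).antisymm
    (Ioi_ae_eq_Ici.symm.le.trans (LE.le.eventuallyLE hsup))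

lemma IsLowerSet.isThreshold {S : Set ℝ} (hS : IsLowerSet S) (h0 : S.Nonempty)
    (h1 : S ≠ Set.univ) : IsThreshold S := by
  have := IsUpperSet.isThreshold hS.compl (Set.nonempty_compl.2 h1)
    (fun h => h0.ne_empty (Set.compl_univ_iff.1 h))
  simpa only [compl_compl] using this.compl

lemma convex_real_classify {S : Set ℝ} (hS : Convex ℝ S) (h0 : S.Nonempty) (h1 : S ≠ Set.univ) :
    IsThreshold S ∨ ∃ a b, a ≤ b ∧ S =ᵐ[volume] Set.Icc a b := by
  have hoc := hS.ordConnected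
  by_cases hb : BddBelow S
  · by_cases ht : BddAbove S
    · right
      refine ⟨sInf S, sSup S, csInf_le_csSup h0 hb ht, ?_⟩
      have hsub : S ⊆ Set.Icc (sInf S) (sSup S) := fun y hy => ⟨csInf_le hb hy, le_csSup ht hy⟩
      have hsup : Set.Ioo (sInf S) (sSup S) ⊆ S := fun y hy => by
        obtain ⟨s, hs, hsy⟩ := exists_lt_of_csInf_lt h0 hy.1
        obtain ⟨r, hr, hry⟩ := exists_lt_of_lt_csSup h0 hy.2
        exact hoc.out hs hr ⟨hsy.le, hry.le⟩
      exact (LE.le.eventuallyLE hsub).antisymm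
        (Ioo_ae_eq_Icc.symm.le.trans (LE.le.eventuallyLE hsup))
    · refine Or.inl (IsUpperSet.isThreshold (fun y z hyz hy => ?_) h0 h1)
      obtain ⟨s, hs, hsy⟩ := not_bddAbove_iff.1 ht z
      exact hoc.out hy hs ⟨hyz, hsy.le⟩
  · refine Or.inl (IsLowerSet.isThreshold (fun y z hyz hy => ?_) h0 h1)
    obtain ⟨s, hs, hsy⟩ := not_bddBelow_iff.1 hb z
    exact hoc.out hs hy ⟨hsy.le, hyz⟩

/-! ### Improving a region for a given input. -/

section Regions

variable {v : ℝ≥0} {D : Set ℝ}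

lemma not_ae_trivial_of_info_pos {ι : Type*} [Fintype ι] (hv : v ≠ 0) {a x : ι → ℝ}
    (ha1 : ∑ i, a i = 1) (hpos : 0 < info a (pr v D ∘ x)) :
    ¬ D =ᵐ[volume] (∅ : Set ℝ) ∧ ¬ D =ᵐ[volume] Set.univ := by
  constructor
  · intro h
    rw [pr_congr hv h, pr_empty] at hpos
    exact hpos.ne' (info_const ha1 0)
  · intro h
    rw [pr_congr hv h, pr_univ] at hpos
    exact hpos.ne' (info_const ha1 1)

lemma gaussianPDFReal_eq_mul_exp (hv : v ≠ 0) (x y : ℝ) :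
    gaussianPDFReal x v y = (√(2 * Real.pi * v))⁻¹ * exp (-y ^ 2 / (2 * v)) *
      (exp (-x ^ 2 / (2 * v)) * exp (x / v * y)) := by
  have hv' : (v : ℝ) ≠ 0 := by exact_mod_cast hv
  rw [gaussianPDFReal, ← Real.exp_add, mul_assoc _ (exp _), ← Real.exp_add]
  congr 2
  field_simp
  ring

/-- For a given input, the regions of largest mutual information are those on which a combination
of Gaussian densities, with the log-odds as coefficients, is positive. -/
lemma exists_better_region (hv : v ≠ 0) (hD : MeasurableSet D) {P : ℝ} {a x : Fin 3 → ℝ}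
    (h : Feasible P a x) (hx : Monotone x) (hpos : 0 < info a (pr v D ∘ x)) :
    ∃ T : Set ℝ, MeasurableSet T ∧ (Convex ℝ T ∨ Convex ℝ Tᶜ) ∧
      (Monotone (pr v D ∘ x) → IsUpperSet T) ∧ (Antitone (pr v D ∘ x) → IsLowerSet T) ∧
      info a (pr v D ∘ x) ≤ info a (pr v T ∘ x) ∧
      (D =ᵐ[volume] T ∨ info a (pr v D ∘ x) < info a (pr v T ∘ x)) := by
  obtain ⟨hD0, hD1⟩ := not_ae_trivial_of_info_pos hv h.sum_eq hpos
  have hv' : (0 : ℝ) < v := NNReal.coe_pos.2 (pos_iff_ne_zero.2 hv)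
  set u : Fin 3 → ℝ := pr v D ∘ x with hu_def
  have hu : ∀ i, u i ∈ Set.Ioo (0 : ℝ) 1 := fun i => pr_mem_Ioo hv hD hD0 hD1 (x i)
  set w := logOdds a u
  set c : Fin 3 → ℝ := fun i => a i * w i * exp (-x i ^ 2 / (2 * v)) with hc
  set k : Fin 3 → ℝ := fun i => x i / v with hk_def
  have hk : Monotone k := fun i j hij => div_le_div_of_nonneg_right (hx hij) hv'.le
  -- The integral of `g` over a region is the linear functional of the tangent at `u`, so the
  -- positivity set of `g` maximises that functional among all regions.
  set g : ℝ → ℝ := fun y => ∑ i, a i * w i * gaussianPDFReal (x i) v y with hg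
  have hgE : ∀ y, g y = (√(2 * Real.pi * v))⁻¹ * exp (-y ^ 2 / (2 * v)) * expSum c k y := by
    intro y
    simp only [hg, expSum, Finset.mul_sum]
    refine Finset.sum_congr rfl fun i _ => ?_
    rw [gaussianPDFReal_eq_mul_exp hv]
    simp only [hc, hk_def]
    ring
  have hfac : ∀ y, 0 < (√(2 * Real.pi * v))⁻¹ * exp (-y ^ 2 / (2 * v)) := fun y => by positivity
  have hgi : Integrable g := integrable_finsetSum _ fun i _ =>
    (integrable_gaussianPDFReal (x i) v).const_mul _
  have hint : ∀ E : Set ℝ, ∫ y in E, g y = ∑ i, a i * w i * pr v E (x i) := by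
    intro E
    simp only [hg]
    rw [integral_finsetSum _ fun i _ =>
      ((integrable_gaussianPDFReal (x i) v).const_mul _).integrableOn]
    refine Finset.sum_congr rfl fun i _ => ?_
    rw [integral_const_mul, pr_eq_integral hv]
  -- If `g` vanished identically, `info_le_sum_logOdds` would force the information to be at most
  -- zero.
  obtain ⟨y₀, hy₀⟩ : ∃ y, expSum c k y ≠ 0 := by
    by_contra! hz
    have h1 := info_le_sum_logOdds h.nonneg h.sum_eq hu
    have h2 := hint D
    have h3 : g = fun _ => 0 := funext fun y => by rw [hgE, hz, mul_zero]
    rw [h3] at h2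
    simp only [integral_zero] at h2
    have h4 : ∑ i, a i * w i * u i = 0 := h2.symm
    linarith
  have hnull := volume_zeros_eq_zero (analyticOnNhd_expSum c k) hy₀
  set T : Set ℝ := {y | 0 < expSum c k y} with hT_def
  have hT : MeasurableSet T := measurableSet_lt measurable_const (measurable_expSum c k)
  have hgT : ∀ y, y ∈ T ↔ 0 < g y := fun y => by
    rw [hgE, mul_pos_iff_of_pos_left (hfac y)]; rfl
  -- The integral of `F` is the gain in the linear term on passing from `D` to `T`, a lower bound
  -- for the gain in information.
  set F : ℝ → ℝ := fun y => T.indicator g y - D.indicator g y with hF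
  have hF0 : ∀ y, 0 ≤ F y := by
    intro y
    simp only [hF, Set.indicator_apply]
    by_cases hyT : y ∈ T
    · have := (hgT y).1 hyT
      by_cases hyD : y ∈ D <;> simp [hyT, hyD, this.le]
    · have := not_lt.1 (mt (hgT y).2 hyT)
      by_cases hyD : y ∈ D <;> simp [hyT, hyD, this]
  have hFi : Integrable F := (hgi.indicator hT).sub (hgi.indicator hD)
  have hFint : ∫ y, F y = ∑ i, a i * w i * ((pr v T ∘ x) i - u i) := by
    simp only [hF]
    rw [integral_sub (hgi.indicator hT) (hgi.indicator hD), integral_indicator hT,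
      integral_indicator hD, hint, hint, ← Finset.sum_sub_distrib]
    refine Finset.sum_congr rfl fun i _ => ?_
    simp only [hu_def, Function.comp_apply]
    ring
  have htan : info a u + ∑ i, a i * w i * ((pr v T ∘ x) i - u i) ≤ info a (pr v T ∘ x) :=
    info_tangent_le h.nonneg h.sum_eq hu fun i => pr_mem_Icc (x i)
  rw [← hFint] at htan
  have hFn : 0 ≤ ∫ y, F y := integral_nonneg hF0
  have hcs : ∀ i, (0 ≤ w i → 0 ≤ c i) ∧ (w i ≤ 0 → c i ≤ 0) := fun i =>
    ⟨fun hw => mul_nonneg (mul_nonneg (h.nonneg i) hw) (Real.exp_pos _).le, fun hw =>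
      mul_nonpos_of_nonpos_of_nonneg (mul_nonpos_of_nonneg_of_nonpos (h.nonneg i) hw)
        (Real.exp_pos _).le⟩
  refine ⟨T, hT, convex_expSum_pos hk, fun hm => ?_, fun hm => ?_, by linarith, ?_⟩
  · exact isUpperSet_expSum_pos hk
      ((hcs 0).2 (logOdds_nonpos h.nonneg h.sum_eq hu fun i => hm (Fin.zero_le i)))
      ((hcs 2).1 (logOdds_nonneg h.nonneg h.sum_eq hu fun i => hm (Fin.le_last i)))
  · exact isLowerSet_expSum_pos hk
      ((hcs 0).1 (logOdds_nonneg h.nonneg h.sum_eq hu fun i => hm (Fin.zero_le i)))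
      ((hcs 2).2 (logOdds_nonpos h.nonneg h.sum_eq hu fun i => hm (Fin.le_last i)))
  · rcases hFn.eq_or_lt with h0 | hlt
    · left
      -- With no gain, `g` vanishes almost everywhere on the symmetric difference of `D` and `T`;
      -- since its zeros are null, the two sets agree almost everywhere.
      have hFz := (integral_eq_zero_iff_of_nonneg hF0 hFi).1 h0.symm
      have hgz : ∀ᵐ y : ℝ, expSum c k y ≠ 0 := by
        rw [ae_iff]; simpa using hnull
      refine Filter.eventuallyEq_set.2 ?_
      filter_upwards [hFz, hgz] with y hy hyz
      have hgy : g y ≠ 0 := by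
        rw [hgE]; exact mul_ne_zero (hfac y).ne' hyz
      simp only [hF, Set.indicator_apply, Pi.zero_apply] at hy
      by_cases hyT : y ∈ T <;> by_cases hyD : y ∈ D <;> simp [hyT, hyD, hgy] at hy ⊢
    · right; linarith

lemma info_pr_compl {P : ℝ} {a x : Fin 3 → ℝ} (h : Feasible P a x) (hD : MeasurableSet D) :
    info a (pr v Dᶜ ∘ x) = info a (pr v D ∘ x) := by
  have : pr v Dᶜ ∘ x = fun i => 1 - (pr v D ∘ x) i := funext fun i => pr_compl hD (x i)
  rw [this, info_one_sub h.sum_eq]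

lemma IsThreshold.exists_info_eq (hv : v ≠ 0) (hD : MeasurableSet D) (hT : IsThreshold D) :
    ∃ t : ℝ, ∀ (P : ℝ) (a x : Fin 3 → ℝ), Feasible P a x →
      info a (pr v (Set.Ici t) ∘ x) = info a (pr v D ∘ x) := by
  obtain ⟨t, ht | ht⟩ := hT
  · exact ⟨t, fun P a x _ => by rw [pr_congr hv ht]⟩
  · exact ⟨t, fun P a x h => by rw [← pr_congr hv ht, info_pr_compl h hD]⟩

/-- Reflecting the input points about the midpoint of an interval, towards the side of the origin,
does not change the channel of that interval and does not increase the power. -/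
lemma Feasible.exists_fold (hv : v ≠ 0) {P : ℝ} {a x : Fin 3 → ℝ} (h : Feasible P a x)
    {l r : ℝ} (hlr : l ≤ r) : ∃ y : Fin 3 → ℝ, Feasible P a y ∧
      pr v (Set.Icc l r) ∘ y = pr v (Set.Icc l r) ∘ x ∧
      ((∀ i, y i ≤ (l + r) / 2) ∨ ∀ i, (l + r) / 2 ≤ y i) := by
  have hpow : ∀ y : Fin 3 → ℝ, (∀ i, y i ^ 2 ≤ x i ^ 2) → Feasible P a y := fun y hy =>
    ⟨h.nonneg, h.sum_eq, le_trans
      (Finset.sum_le_sum fun i _ => mul_le_mul_of_nonneg_left (hy i) (h.nonneg i)) h.power⟩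
  have hval : ∀ i (z : ℝ), z = x i ∨ z = l + r - x i →
      pr v (Set.Icc l r) z = pr v (Set.Icc l r) (x i) := by
    rintro i z (rfl | rfl)
    · rfl
    · exact pr_Icc_reflect hv hlr _
  -- The side containing the origin is kept: a point beyond the midpoint on the other side does not
  -- gain absolute value when reflected.
  rcases le_total 0 (l + r) with hm | hm
  · refine ⟨fun i => min (x i) (l + r - x i), hpow _ fun i => ?_,
      funext fun i => hval i _ (min_choice _ _), Or.inl fun i => ?_⟩
    · rcases min_cases (x i) (l + r - x i) with h1 | h1 <;> rw [h1.1]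
      nlinarith
    · rcases min_cases (x i) (l + r - x i) with h1 | h1 <;> simp only [h1.1] <;> linarith
  · refine ⟨fun i => max (x i) (l + r - x i), hpow _ fun i => ?_,
      funext fun i => hval i _ (max_choice _ _), Or.inr fun i => ?_⟩
    · rcases max_cases (x i) (l + r - x i) with h1 | h1 <;> rw [h1.1]
      nlinarith
    · rcases max_cases (x i) (l + r - x i) with h1 | h1 <;> simp only [h1.1] <;> linarith

lemma isThreshold_of_upper_or_lower {T : Set ℝ} (h : IsUpperSet T ∨ IsLowerSet T)
    (h0 : ¬ T =ᵐ[volume] (∅ : Set ℝ)) (h1 : ¬ T =ᵐ[volume] Set.univ) : IsThreshold T := by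
  have h0' : T.Nonempty := by
    rw [Set.nonempty_iff_ne_empty]
    rintro rfl
    exact h0 (Filter.EventuallyEq.refl _ _)
  have h1' : T ≠ Set.univ := by
    rintro rfl
    exact h1 (Filter.EventuallyEq.refl _ _)
  rcases h with h | h
  · exact IsUpperSet.isThreshold h h0' h1'
  · exact IsLowerSet.isThreshold h h0' h1'

/-- After folding, all inputs lie on one side of the midpoint, where the channel of the interval is
monotone. The improved region is therefore a ray, and the gain is strict because the interval is not
of threshold form. -/
lemma exists_threshold_info_gt_of_Icc (hv : v ≠ 0) {P : ℝ} {a x : Fin 3 → ℝ}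
    (h : Feasible P a x) {l r : ℝ} (hlr : l ≤ r) (hn : ¬ IsThreshold (Set.Icc l r))
    (hpos : 0 < info a (pr v (Set.Icc l r) ∘ x)) :
    ∃ (t : ℝ) (b y : Fin 3 → ℝ), Feasible P b y ∧
      info a (pr v (Set.Icc l r) ∘ x) < info b (pr v (Set.Ici t) ∘ y) := by
  obtain ⟨z, hz, hzx, hside⟩ := h.exists_fold hv hlr
  obtain ⟨b, y, hy, hym, hyz, hinfo⟩ := hz.exists_sorted
  have heq : info b (pr v (Set.Icc l r) ∘ y) = info a (pr v (Set.Icc l r) ∘ x) := by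
    rw [hinfo, hzx]
  obtain ⟨T, hT, -, hup, hlow, hle, hlt⟩ :=
    exists_better_region hv measurableSet_Icc hy hym (by rwa [heq])
  obtain ⟨hT0, hT1⟩ := not_ae_trivial_of_info_pos hv hy.sum_eq
    (lt_of_lt_of_le (by rwa [heq]) hle)
  have hTt : IsThreshold T := by
    refine isThreshold_of_upper_or_lower ?_ hT0 hT1
    rcases hside with hs | hs
    · refine Or.inl (hup fun i j hij => ?_)
      have hs' : ∀ i, y i ≤ (l + r) / 2 := fun i => by
        obtain ⟨j, hj⟩ := hyz i
        rw [hj]; exact hs j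
      exact pr_Icc_monotoneOn hv hlr (hs' i) (hs' j) (hym hij)
    · refine Or.inr (hlow fun i j hij => ?_)
      have hs' : ∀ i, (l + r) / 2 ≤ y i := fun i => by
        obtain ⟨j, hj⟩ := hyz i
        rw [hj]; exact hs j
      exact pr_Icc_antitoneOn hv hlr (hs' i) (hs' j) (hym hij)
  obtain ⟨t, ht⟩ := hTt.exists_info_eq hv hT
  refine ⟨t, b, y, hy, ?_⟩
  rw [ht P b y hy, ← heq]
  exact hlt.resolve_left fun he => hn (hTt.congr he.symm)

/-- A region that is not of threshold form is strictly worse than some threshold region. -/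
lemma isThreshold_or_exists_info_gt (hv : v ≠ 0) (hD : MeasurableSet D) {P : ℝ}
    {a x : Fin 3 → ℝ} (h : Feasible P a x) (hpos : 0 < info a (pr v D ∘ x)) :
    IsThreshold D ∨ ∃ (t : ℝ) (b y : Fin 3 → ℝ), Feasible P b y ∧
      info a (pr v D ∘ x) < info b (pr v (Set.Ici t) ∘ y) := by
  obtain ⟨b, y, hy, hym, -, hinfo⟩ := h.exists_sorted
  rw [← hinfo] at hpos ⊢
  obtain ⟨T, hT, hconv, -, -, hle, hlt⟩ := exists_better_region hv hD hy hym hpos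
  by_cases hTt : IsThreshold T
  · rcases hlt with he | hlt
    · exact Or.inl (hTt.congr he.symm)
    · obtain ⟨t, ht⟩ := hTt.exists_info_eq hv hT
      exact Or.inr ⟨t, b, y, hy, by rwa [ht P b y hy]⟩
  right
  have hTpos : 0 < info b (pr v T ∘ y) := hpos.trans_le hle
  obtain ⟨hT0, hT1⟩ := not_ae_trivial_of_info_pos hv hy.sum_eq hTpos
  have h0' : T.Nonempty := by
    rw [Set.nonempty_iff_ne_empty]
    rintro rfl
    exact hT0 (Filter.EventuallyEq.refl _ _)
  have h1' : T ≠ Set.univ := by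
    rintro rfl
    exact hT1 (Filter.EventuallyEq.refl _ _)
  obtain ⟨l, r, hlr, hIcc, hinf⟩ : ∃ l r, l ≤ r ∧ ¬ IsThreshold (Set.Icc l r) ∧
      info b (pr v (Set.Icc l r) ∘ y) = info b (pr v T ∘ y) := by
    rcases hconv with hc | hc
    · obtain ht | ⟨l, r, hlr, he⟩ := convex_real_classify hc h0' h1'
      · exact absurd ht hTt
      · exact ⟨l, r, hlr, fun ht => hTt (ht.congr he.symm), by rw [pr_congr hv he]⟩
    · obtain ht | ⟨l, r, hlr, he⟩ := convex_real_classify hc (Set.nonempty_compl.2 h1')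
        (fun he => h0'.ne_empty (Set.compl_univ_iff.1 he))
      · exact absurd (by simpa only [compl_compl] using ht.compl) hTt
      · refine ⟨l, r, hlr, fun ht => hTt ?_, by rw [← pr_congr hv he, info_pr_compl hy hT]⟩
        simpa only [compl_compl] using (ht.congr he.symm).compl
  obtain ⟨t, b', y', hy', hlt'⟩ := exists_threshold_info_gt_of_Icc hv hy hlr hIcc
    (by rwa [hinf])
  exact ⟨t, b', y', hy', hle.trans_lt (hinf ▸ hlt')⟩

end Regions

/-! ### Mutual information of an arbitrary input as a difference of entropies. -/

open InformationTheory (klFun)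

section MutualInfo

variable {v : ℝ≥0} {D : Set ℝ} {μ : Measure ℝ}

lemma measurable_pr (hv : v ≠ 0) : Measurable (pr v D) := (continuous_pr hv D).measurable

lemma integrable_pr [IsProbabilityMeasure μ] (hv : v ≠ 0) : Integrable (pr v D) μ :=
  Integrable.of_bound (measurable_pr hv).aestronglyMeasurable 1 <|
    Filter.Eventually.of_forall fun x => by
      rw [Real.norm_of_nonneg (pr_mem_Icc x).1]; exact (pr_mem_Icc x).2

lemma integrable_binEntropy_pr [IsProbabilityMeasure μ] (hv : v ≠ 0) :
    Integrable (fun x => binEntropy (pr v D x)) μ :=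
  Integrable.of_bound
    (Real.binEntropy_continuous.measurable.comp (measurable_pr hv)).aestronglyMeasurable (log 2) <|
    Filter.Eventually.of_forall fun x => by
      rw [Real.norm_of_nonneg (Real.binEntropy_nonneg (pr_mem_Icc x).1 (pr_mem_Icc x).2)]
      exact Real.binEntropy_le_log_two

lemma integral_pr_mem_Icc [IsProbabilityMeasure μ] (hv : v ≠ 0) :
    ∫ x, pr v D x ∂μ ∈ Set.Icc (0 : ℝ) 1 := by
  refine ⟨integral_nonneg fun x => (pr_mem_Icc x).1, ?_⟩
  have := integral_mono (integrable_pr (D := D) hv) (integrable_const (μ := μ) (1 : ℝ))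
    fun x => (pr_mem_Icc x).2
  simpa using this

lemma measurable_quantize (hD : MeasurableSet D) : Measurable (quantize D) :=
  Measurable.ite hD measurable_const measurable_const

lemma gaussianReal_quantize (hD : MeasurableSet D) (x : ℝ) (t : Set ℤ) :
    gaussianReal 0 v {z | quantize D (x + z) ∈ t} =
      ENNReal.ofReal (pr v D x) * t.indicator 1 1 +
        ENNReal.ofReal (1 - pr v D x) * t.indicator 1 (-1) := by
  have hm : MeasurableSet {y | quantize D y ∈ t} := measurable_quantize hD (MeasurableSet.of_discrete)
  have h1 : gaussianReal 0 v {z | quantize D (x + z) ∈ t} =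
      gaussianReal x v {y | quantize D y ∈ t} := by
    have := gaussianReal_map_const_add (μ := 0) (v := v) x
    rw [zero_add] at this
    rw [← this, Measure.map_apply (by fun_prop) hm]
    rfl
  have hpD : gaussianReal x v D = ENNReal.ofReal (pr v D x) := by simp [pr]
  have hpDc : gaussianReal x v Dᶜ = ENNReal.ofReal (1 - pr v D x) := by
    rw [← pr_compl hD]; simp [pr]
  rw [h1]
  by_cases ht1 : (1 : ℤ) ∈ t <;> by_cases ht2 : (-1 : ℤ) ∈ t
  · have : {y | quantize D y ∈ t} = Set.univ := by
      ext y; by_cases hy : y ∈ D <;> simp [quantize, hy, ht1, ht2]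
    simp only [this, ht1, ht2, Set.indicator_of_mem, Pi.one_apply, mul_one, measure_univ]
    rw [← hpD, ← hpDc, prob_add_prob_compl hD]
  · have : {y | quantize D y ∈ t} = D := by
      ext y; by_cases hy : y ∈ D <;> simp [quantize, hy, ht1, ht2]
    simp [this, ht1, ht2, hpD]
  · have : {y | quantize D y ∈ t} = Dᶜ := by
      ext y; by_cases hy : y ∈ D <;> simp [quantize, hy, ht1, ht2]
    simp [this, ht1, ht2, hpDc]
  · have : {y | quantize D y ∈ t} = ∅ := by
      ext y; by_cases hy : y ∈ D <;> simp [quantize, hy, ht1, ht2]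
    simp [this, ht1, ht2]

lemma jointLaw_prod [IsProbabilityMeasure μ] (hD : MeasurableSet D) {s : Set ℝ}
    (hs : MeasurableSet s) (t : Set ℤ) :
    jointLaw v D μ (s ×ˢ t) = ∫⁻ x in s, (ENNReal.ofReal (pr v D x) * t.indicator 1 1 +
        ENNReal.ofReal (1 - pr v D x) * t.indicator 1 (-1)) ∂μ := by
  have hf : Measurable fun p : ℝ × ℝ => (p.1, quantize D (p.1 + p.2)) :=
    measurable_fst.prodMk ((measurable_quantize hD).comp (measurable_fst.add measurable_snd))
  have hst : MeasurableSet (s ×ˢ t) := hs.prod MeasurableSet.of_discrete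
  rw [jointLaw, Measure.map_apply hf hst, Measure.prod_apply (hf hst), ← lintegral_indicator hs]
  refine lintegral_congr fun x => ?_
  by_cases hx : x ∈ s
  · rw [Set.indicator_of_mem hx, ← gaussianReal_quantize hD]
    congr 1
    ext z; simp [hx]
  · rw [Set.indicator_of_notMem hx]
    convert measure_empty (μ := gaussianReal 0 v)
    ext z; simp [hx]

/-- The law of an output that is `1` with probability `q`, and `-1` otherwise. -/
noncomputable def outputLaw (q : ℝ) : Measure ℤ :=
  ENNReal.ofReal q • Measure.dirac 1 + ENNReal.ofReal (1 - q) • Measure.dirac (-1)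

instance (q : ℝ) : IsFiniteMeasure (outputLaw q) := by
  constructor
  simp [outputLaw]

lemma lintegral_prod_outputLaw [SFinite μ] (q : ℝ) {G : ℝ × ℤ → ℝ≥0∞} (hG : Measurable G) :
    ∫⁻ z, G z ∂(μ.prod (outputLaw q)) =
      ∫⁻ x, (ENNReal.ofReal q * G (x, 1) + ENNReal.ofReal (1 - q) * G (x, -1)) ∂μ := by
  rw [lintegral_prod _ hG.aemeasurable]
  refine lintegral_congr fun x => ?_
  simp [outputLaw, lintegral_add_measure, lintegral_smul_measure]

lemma jointLaw_fst [IsProbabilityMeasure μ] (hD : MeasurableSet D) :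
    (jointLaw v D μ).fst = μ := by
  ext s hs
  have h : Prod.fst ⁻¹' s = s ×ˢ (Set.univ : Set ℤ) := by ext; simp
  rw [Measure.fst_apply hs, h, jointLaw_prod hD hs]
  have : ∀ x, ENNReal.ofReal (pr v D x) * (Set.univ : Set ℤ).indicator 1 1 +
      ENNReal.ofReal (1 - pr v D x) * (Set.univ : Set ℤ).indicator 1 (-1) = 1 := fun x => by
    have hx := pr_mem_Icc (v := v) (D := D) x
    simp only [Set.indicator_univ, Pi.one_apply, mul_one]
    rw [← ENNReal.ofReal_add hx.1 (by linarith [hx.2])]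
    simp
  rw [lintegral_congr this]
  simp

lemma jointLaw_snd [IsProbabilityMeasure μ] (hv : v ≠ 0) (hD : MeasurableSet D) :
    (jointLaw v D μ).snd = outputLaw (∫ x, pr v D x ∂μ) := by
  ext t ht
  have h : Prod.snd ⁻¹' t = (Set.univ : Set ℝ) ×ˢ t := by ext; simp
  rw [Measure.snd_apply ht, h, jointLaw_prod hD MeasurableSet.univ, Measure.restrict_univ]
  have hm := measurable_pr (D := D) hv
  have hi : Integrable (fun x => 1 - pr v D x) μ := (integrable_const 1).sub (integrable_pr hv)
  rw [lintegral_add_left (by fun_prop), lintegral_mul_const _ (by fun_prop),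
    lintegral_mul_const _ (by fun_prop),
    ← ofReal_integral_eq_lintegral_ofReal (integrable_pr hv)
      (Filter.Eventually.of_forall fun x => (pr_mem_Icc x).1),
    ← ofReal_integral_eq_lintegral_ofReal hi
      (Filter.Eventually.of_forall fun x => sub_nonneg.2 (pr_mem_Icc x).2)]
  have : ∫ x, (1 - pr v D x) ∂μ = 1 - ∫ x, pr v D x ∂μ := by
    rw [integral_sub (integrable_const 1) (integrable_pr hv)]
    simp
  rw [this]
  simp [outputLaw, Measure.dirac_apply']

/-- The Gaussian density is positive everywhere, so `pr v D` is identically 0, identically 1, or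
strictly between them at every point. This justifies the quotients by `q` and `1 - q` in
`mutualInfo_eq` even when a denominator is zero. -/
lemma mul_div_integral_pr [IsProbabilityMeasure μ] (hv : v ≠ 0) (hD : MeasurableSet D) (x : ℝ) :
    (∫ x, pr v D x ∂μ = 0 → pr v D x = 0) ∧ (1 - ∫ x, pr v D x ∂μ = 0 → 1 - pr v D x = 0) := by
  by_cases h0 : D =ᵐ[volume] (∅ : Set ℝ)
  · rw [pr_congr hv h0, pr_empty]; simp
  by_cases h1 : D =ᵐ[volume] Set.univ
  · rw [pr_congr hv h1, pr_univ]; simp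
  have hpos : ∀ f : ℝ → ℝ, Integrable f μ → (∀ x, 0 < f x) → ∫ x, f x ∂μ ≠ 0 := by
    intro f hf hf0 hz
    have h := (integral_eq_zero_iff_of_nonneg (fun x => (hf0 x).le) hf).1 hz
    obtain ⟨y, hy⟩ := h.exists
    exact (hf0 y).ne' hy
  have hp := fun x => pr_mem_Ioo hv hD h0 h1 x
  refine ⟨fun hz => absurd hz (hpos _ (integrable_pr hv) fun x => (hp x).1), fun hz => ?_⟩
  refine absurd ?_ (hpos (fun x => 1 - pr v D x) ((integrable_const 1).sub (integrable_pr hv))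
    fun x => sub_pos.2 (hp x).2)
  rw [integral_sub (integrable_const 1) (integrable_pr hv)]
  simpa using hz

lemma mul_klFun_div {p q : ℝ} (h : q = 0 → p = 0) :
    q * klFun (p / q) = p * log p - p * log q + q - p := by
  by_cases hq : q = 0
  · simp [hq, h hq]
  rw [InformationTheory.klFun_apply]
  by_cases hp : p = 0
  · simp [hp]
  rw [Real.log_div hp hq]
  field_simp

/-- The mutual information is the entropy of the output minus its conditional entropy. -/
lemma mutualInfo_eq [IsProbabilityMeasure μ] (hv : v ≠ 0) (hD : MeasurableSet D) :
    mutualInfo v D μ =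
      ENNReal.ofReal (binEntropy (∫ x, pr v D x ∂μ) - ∫ x, binEntropy (pr v D x) ∂μ) := by
  have hq01 := integral_pr_mem_Icc (μ := μ) (D := D) hv
  have hz := mul_div_integral_pr (μ := μ) hv hD
  have hfst := jointLaw_fst (v := v) (μ := μ) hD
  have hsnd := jointLaw_snd (μ := μ) hv hD
  have hm := measurable_pr (D := D) hv
  set p := pr v D with hp
  set q := ∫ x, p x ∂μ with hq
  have hp01 : ∀ x, p x ∈ Set.Icc (0 : ℝ) 1 := fun x => pr_mem_Icc x
  have hq1 : 0 ≤ 1 - q := sub_nonneg.2 hq01.2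
  -- The likelihood ratio of the joint law to the product of its marginals; `hjoint` verifies this
  -- on rectangles.
  set r : ℝ × ℤ → ℝ≥0∞ := fun z =>
    if z.2 = 1 then ENNReal.ofReal (p z.1 / q) else ENNReal.ofReal ((1 - p z.1) / (1 - q)) with hr
  have hrm : Measurable r := by
    refine Measurable.ite (measurable_snd (MeasurableSet.of_discrete (s := {(1 : ℤ)}))) ?_ ?_
    · fun_prop
    · fun_prop
  have hr1 : ∀ x, ENNReal.ofReal q * r (x, 1) = ENNReal.ofReal (p x) := fun x => by
    simp only [hr, if_true]
    rw [← ENNReal.ofReal_mul hq01.1, mul_div_cancel_of_imp' (hz x).1]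
  have hr2 : ∀ x, ENNReal.ofReal (1 - q) * r (x, -1) = ENNReal.ofReal (1 - p x) := fun x => by
    have : ¬ (-1 : ℤ) = 1 := by decide
    simp only [hr, this, if_false]
    rw [← ENNReal.ofReal_mul hq1, mul_div_cancel_of_imp' (hz x).2]
  have hjoint : jointLaw v D μ = (μ.prod (outputLaw q)).withDensity r := by
    have : IsFiniteMeasure (jointLaw v D μ) := by
      unfold jointLaw; infer_instance
    refine Measure.ext_prod fun {s t} hs ht => ?_
    rw [jointLaw_prod hD hs, withDensity_apply _ (hs.prod ht), ← lintegral_indicator (hs.prod ht),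
      lintegral_prod_outputLaw _ (hrm.indicator (hs.prod ht)), ← lintegral_indicator hs]
    refine lintegral_congr fun x => ?_
    by_cases hx : x ∈ s <;> by_cases ht1 : (1 : ℤ) ∈ t <;> by_cases ht2 : (-1 : ℤ) ∈ t <;>
      simp [hx, ht1, ht2, hr1, hr2, ← hp]
  have hac : jointLaw v D μ ≪ μ.prod (outputLaw q) := by
    rw [hjoint]; exact withDensity_absolutelyContinuous _ _
  have hfin : IsFiniteMeasure (jointLaw v D μ) := by
    unfold jointLaw; infer_instance
  rw [mutualInfo, hfst, hsnd, InformationTheory.klDiv_eq_lintegral_klFun_of_ac hac]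
  have hrn : (jointLaw v D μ).rnDeriv (μ.prod (outputLaw q)) =ᵐ[μ.prod (outputLaw q)] r := by
    rw [hjoint]; exact Measure.rnDeriv_withDensity _ hrm
  have hstep : ∫⁻ z, ENNReal.ofReal (klFun (((jointLaw v D μ).rnDeriv
      (μ.prod (outputLaw q)) z).toReal)) ∂(μ.prod (outputLaw q)) =
      ∫⁻ z, ENNReal.ofReal (klFun (r z).toReal) ∂(μ.prod (outputLaw q)) := by
    refine lintegral_congr_ae ?_
    filter_upwards [hrn] with z hz
    rw [hz]
  have hkm : Measurable fun z => ENNReal.ofReal (klFun (r z).toReal) :=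
    (InformationTheory.measurable_klFun.comp hrm.ennreal_toReal).ennreal_ofReal
  rw [hstep, lintegral_prod_outputLaw _ hkm]
  have hpt : ∀ x, ENNReal.ofReal q * ENNReal.ofReal (klFun (r (x, 1)).toReal) +
      ENNReal.ofReal (1 - q) * ENNReal.ofReal (klFun (r (x, -1)).toReal) =
      ENNReal.ofReal (-binEntropy (p x) - p x * log q - (1 - p x) * log (1 - q)) := by
    intro x
    have : ¬ (-1 : ℤ) = 1 := by decide
    have hn1 : 0 ≤ p x / q := div_nonneg (hp01 x).1 hq01.1
    have hn2 : 0 ≤ (1 - p x) / (1 - q) := div_nonneg (sub_nonneg.2 (hp01 x).2) hq1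
    simp only [hr, this, if_true, if_false]
    rw [ENNReal.toReal_ofReal hn1, ENNReal.toReal_ofReal hn2, ← ENNReal.ofReal_mul hq01.1,
      ← ENNReal.ofReal_mul hq1, ← ENNReal.ofReal_add
        (mul_nonneg hq01.1 (InformationTheory.klFun_nonneg hn1))
        (mul_nonneg hq1 (InformationTheory.klFun_nonneg hn2)),
      mul_klFun_div (hz x).1, mul_klFun_div (hz x).2, binEntropy_eq_logs]
    congr 1
    ring
  have hpt0 : ∀ x, 0 ≤ -binEntropy (p x) - p x * log q - (1 - p x) * log (1 - q) := by
    intro x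
    have h1 := mul_nonneg hq01.1
      (InformationTheory.klFun_nonneg (div_nonneg (hp01 x).1 hq01.1))
    have h2 := mul_nonneg hq1
      (InformationTheory.klFun_nonneg (div_nonneg (sub_nonneg.2 (hp01 x).2) hq1))
    rw [mul_klFun_div (hz x).1] at h1
    rw [mul_klFun_div (hz x).2] at h2
    rw [binEntropy_eq_logs]
    linarith
  simp_rw [hpt]
  have hi1 : Integrable (fun x => -binEntropy (p x)) μ := (integrable_binEntropy_pr hv).neg
  have hi2 : Integrable (fun x => p x * log q) μ := (integrable_pr hv).mul_const _
  have hi3 : Integrable (fun x => (1 - p x) * log (1 - q)) μ :=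
    ((integrable_const 1).sub (integrable_pr hv)).mul_const _
  have hi : Integrable
      (fun x => -binEntropy (p x) - p x * log q - (1 - p x) * log (1 - q)) μ :=
    (hi1.sub hi2).sub hi3
  rw [← ofReal_integral_eq_lintegral_ofReal hi
    (Filter.Eventually.of_forall hpt0)]
  congr 1
  have e1 : ∫ x, (-binEntropy (p x) - p x * log q - (1 - p x) * log (1 - q)) ∂μ =
      -(∫ x, binEntropy (p x) ∂μ) - q * log q - (1 - q) * log (1 - q) := by
    have hi12 : Integrable (fun x => -binEntropy (p x) - p x * log q) μ := hi1.sub hi2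
    rw [integral_sub hi12 hi3, integral_sub hi1 hi2, integral_neg, integral_mul_const,
      integral_mul_const, integral_sub (integrable_const 1) (integrable_pr hv)]
    simp only [integral_const, probReal_univ, smul_eq_mul, mul_one]
    rfl
  refine Eq.trans e1 ?_
  rw [binEntropy_eq_logs q]
  ring

end MutualInfo

open Filter Topology

/-! ### From arbitrary input laws to finitely supported ones. -/

section Discretization

variable {v : ℝ≥0} {D : Set ℝ} {μ : Measure ℝ} {P : ℝ}

lemma ofReal_info_le_capacityOfRegion (hv : v ≠ 0) (hD : MeasurableSet D)
    {ι : Type*} [Fintype ι] {a x : ι → ℝ} (h : Feasible P a x) :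
    ENNReal.ofReal (info a (pr v D ∘ x)) ≤ capacityOfRegion P v D := by
  set μ : Measure ℝ := ∑ i, ENNReal.ofReal (a i) • Measure.dirac (x i) with hμ
  have hprob : IsProbabilityMeasure μ := by
    constructor
    rw [hμ, Measure.finsetSum_apply]
    simp only [Measure.smul_apply, measure_univ, smul_eq_mul, mul_one]
    rw [← ENNReal.ofReal_sum_of_nonneg fun i _ => h.nonneg i, h.sum_eq, ENNReal.ofReal_one]
  have hint : ∀ f : ℝ → ℝ, ∫ y, f y ∂μ = ∑ i, a i * f (x i) := by
    intro f
    rw [hμ, integral_finsetSum_measure fun i _ =>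
      (integrable_dirac (by simp)).smul_measure ENNReal.ofReal_ne_top]
    refine Finset.sum_congr rfl fun i _ => ?_
    rw [integral_smul_measure, integral_dirac, ENNReal.toReal_ofReal (h.nonneg i), smul_eq_mul]
  have hadm : Admissible P μ := by
    refine ⟨hprob, ?_⟩
    rw [hμ, lintegral_finsetSum_measure]
    simp only [lintegral_smul_measure, lintegral_dirac, smul_eq_mul]
    simp_rw [← ENNReal.ofReal_mul (h.nonneg _)]
    rw [← ENNReal.ofReal_sum_of_nonneg fun i _ => mul_nonneg (h.nonneg i) (sq_nonneg _)]
    exact ENNReal.ofReal_le_ofReal h.power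
  have heq : mutualInfo v D μ = ENNReal.ofReal (info a (pr v D ∘ x)) := by
    rw [mutualInfo_eq hv hD, hint, hint]
    rfl
  rw [← heq]
  exact le_iSup₂ (f := fun (μ : Measure ℝ) (_ : Admissible P μ) => mutualInfo v D μ) μ hadm

lemma Admissible.integrable_sq (h : Admissible P μ) : Integrable (fun x : ℝ => x ^ 2) μ := by
  refine ⟨by fun_prop, ?_⟩
  rw [hasFiniteIntegral_iff_ofReal (Eventually.of_forall fun x => sq_nonneg x)]
  exact h.2.trans_lt ENNReal.ofReal_lt_top

lemma Admissible.integral_sq_le (hP : 0 ≤ P) (h : Admissible P μ) : ∫ x, x ^ 2 ∂μ ≤ P := by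
  rw [integral_eq_lintegral_of_nonneg_ae (Eventually.of_forall fun x => sq_nonneg x) (by fun_prop)]
  exact ENNReal.toReal_le_of_le_ofReal hP h.2

lemma integral_comp_simpleFunc [IsFiniteMeasure μ] (φ : SimpleFunc ℝ ℝ) (f : ℝ → ℝ) :
    ∫ x, f (φ x) ∂μ = ∑ z ∈ φ.range, μ.real (φ ⁻¹' {z}) * f z := by
  have h : ∀ x, f (φ x) = ∑ z ∈ φ.range, (φ ⁻¹' {z}).indicator (fun _ => f z) x := by
    intro x
    rw [Finset.sum_eq_single_of_mem (φ x) (φ.mem_range_self x)]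
    · rw [Set.indicator_of_mem (show x ∈ φ ⁻¹' {φ x} from rfl)]
    · intro z _ hz
      exact Set.indicator_of_notMem (s := φ ⁻¹' {z}) (fun hx => hz (Set.mem_singleton_iff.1 hx).symm) _
  simp_rw [h]
  rw [integral_finsetSum _ fun z _ => (integrable_const _).indicator (φ.measurableSet_fiber z)]
  refine Finset.sum_congr rfl fun z _ => ?_
  rw [integral_indicator_const _ (φ.measurableSet_fiber z), smul_eq_mul]

lemma Admissible.exists_feasible_of_simpleFunc (hP : 0 ≤ P) (h : Admissible P μ)
    (φ : SimpleFunc ℝ ℝ) (hφ : ∀ x, |φ x| ≤ |x|) :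
    ∃ (n : ℕ) (a y : Fin n → ℝ), Feasible P a y ∧
      ∀ f : ℝ → ℝ, ∑ i, a i * f (y i) = ∫ x, f (φ x) ∂μ := by
  have := h.1
  set e := φ.range.equivFin.symm
  have hs : ∀ f : ℝ → ℝ, ∑ i, μ.real (φ ⁻¹' {(e i : ℝ)}) * f (e i) = ∫ x, f (φ x) ∂μ := by
    intro f
    rw [integral_comp_simpleFunc, Equiv.sum_comp e fun z => μ.real (φ ⁻¹' {(z : ℝ)}) * f z]
    exact Finset.sum_coe_sort φ.range fun z => μ.real (φ ⁻¹' {z}) * f z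
  refine ⟨_, fun i => μ.real (φ ⁻¹' {(e i : ℝ)}), fun i => e i,
    ⟨fun i => measureReal_nonneg, ?_, ?_⟩, hs⟩
  · simpa using hs fun _ => 1
  · rw [hs fun y => y ^ 2]
    refine le_trans (integral_mono_of_nonneg (Eventually.of_forall fun x => sq_nonneg _)
      h.integrable_sq (Eventually.of_forall fun x => ?_)) (h.integral_sq_le hP)
    exact sq_le_sq.2 (hφ x)

/-- The absolute value is approximated from below and the sign restored. Domination by `|x|` is what
keeps the discretised inputs within the power constraint. -/
lemma exists_simpleFunc_tendsto : ∃ φ : ℕ → SimpleFunc ℝ ℝ, (∀ n x, |φ n x| ≤ |x|) ∧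
    ∀ x, Tendsto (fun n => φ n x) atTop (𝓝 x) := by
  have hf : Measurable fun x : ℝ => ENNReal.ofReal |x| := by fun_prop
  set ψ : ℕ → SimpleFunc ℝ ℝ := fun n =>
    (SimpleFunc.eapprox (fun x : ℝ => ENNReal.ofReal |x|) n).map ENNReal.toReal with hψ
  have hψle : ∀ n x, ψ n x ≤ |x| := fun n x => by
    refine ENNReal.toReal_le_of_le_ofReal (abs_nonneg x) ?_
    rw [← SimpleFunc.iSup_eapprox_apply hf x]
    exact le_iSup (fun n => SimpleFunc.eapprox (fun x : ℝ => ENNReal.ofReal |x|) n x) n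
  have hψ0 : ∀ n x, 0 ≤ ψ n x := fun n x => ENNReal.toReal_nonneg
  have hψt : ∀ x, Tendsto (fun n => ψ n x) atTop (𝓝 |x|) := fun x => by
    have := (ENNReal.tendsto_toReal ENNReal.ofReal_ne_top).comp (SimpleFunc.tendsto_eapprox hf x)
    rwa [ENNReal.toReal_ofReal (abs_nonneg x)] at this
  refine ⟨fun n => SimpleFunc.piecewise (Set.Ici 0) measurableSet_Ici (ψ n)
    ((ψ n).map fun y => -y), fun n x => ?_, fun x => ?_⟩
  · by_cases hx : x ∈ Set.Ici (0 : ℝ)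
    · simpa [SimpleFunc.piecewise_apply, hx, abs_of_nonneg (hψ0 n x)] using hψle n x
    · simpa [SimpleFunc.piecewise_apply, hx, abs_of_nonneg (hψ0 n x)] using hψle n x
  · by_cases hx : x ∈ Set.Ici (0 : ℝ)
    · simpa [SimpleFunc.piecewise_apply, hx, abs_of_nonneg (Set.mem_Ici.1 hx)] using hψt x
    · have hx' : x < 0 := not_le.1 hx
      simpa [SimpleFunc.piecewise_apply, hx, abs_of_neg hx'] using (hψt x).neg

lemma tendsto_integral_comp [IsFiniteMeasure μ] {f : ℝ → ℝ} (hf : Continuous f) {C : ℝ}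
    (hC : ∀ x, |f x| ≤ C) {φ : ℕ → SimpleFunc ℝ ℝ}
    (hφ : ∀ x, Tendsto (fun n => φ n x) atTop (𝓝 x)) :
    Tendsto (fun n => ∫ x, f (φ n x) ∂μ) atTop (𝓝 (∫ x, f x ∂μ)) :=
  tendsto_integral_of_dominated_convergence (fun _ => C)
    (fun n => (hf.measurable.comp (φ n).measurable).aestronglyMeasurable) (integrable_const C)
    (fun n => Eventually.of_forall fun x => hC (φ n x))
    (Eventually.of_forall fun x => (hf.tendsto x).comp (hφ x))

lemma abs_pr_le (x : ℝ) : |pr v D x| ≤ 1 := by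
  rw [abs_of_nonneg (pr_mem_Icc x).1]; exact (pr_mem_Icc x).2

lemma abs_binEntropy_le {p : ℝ} (hp : p ∈ Set.Icc (0 : ℝ) 1) : |binEntropy p| ≤ 1 := by
  rw [abs_of_nonneg (Real.binEntropy_nonneg hp.1 hp.2)]
  exact Real.binEntropy_le_log_two.trans (by linarith [Real.log_two_lt_d9])

/-- The conditional probability and its entropy are bounded continuous functions of the input.
Dominated convergence thus makes the information of any admissible law a limit of values at finite
inputs, each of which reduces to three points. -/
lemma capacityOfRegion_le (hv : v ≠ 0) (hD : MeasurableSet D) (hP : 0 ≤ P) {M : ℝ}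
    (hM : ∀ a x : Fin 3 → ℝ, Feasible P a x → info a (pr v D ∘ x) ≤ M) :
    capacityOfRegion P v D ≤ ENNReal.ofReal M := by
  refine iSup₂_le fun μ h => ?_
  have := h.1
  rw [mutualInfo_eq hv hD]
  refine ENNReal.ofReal_le_ofReal ?_
  obtain ⟨φ, hφ, hφt⟩ := exists_simpleFunc_tendsto
  have hcont := continuous_pr hv D
  have h1 := tendsto_integral_comp (μ := μ) hcont abs_pr_le hφt
  have h2 := tendsto_integral_comp (μ := μ) (Real.binEntropy_continuous.comp hcont)
    (fun x => abs_binEntropy_le (pr_mem_Icc x)) hφt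
  have h3 := ((Real.binEntropy_continuous.tendsto _).comp h1).sub h2
  refine le_of_tendsto h3 (Eventually.of_forall fun n => ?_)
  obtain ⟨m, a, y, hay, hs⟩ := h.exists_feasible_of_simpleFunc hP (φ n) (hφ n)
  obtain ⟨b, z, hbz, hle⟩ := hay.exists_three (pr v D)
  refine le_trans (le_of_eq ?_) (hle.trans (hM b z hbz))
  simp only [Function.comp_apply]
  rw [← hs (pr v D), ← hs fun x => binEntropy (pr v D x)]
  rfl

end Discretization

/-! ### Attainment of the maximum by compactness. -/

section Attainment

/-- A point of a sequence of inputs either stays bounded or, having bounded power, loses all its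
weight; in both cases there is a limit. -/
lemma exists_limit_point {S : Type*} [TopologicalSpace S] (U : Ultrafilter ℕ) {s : ℕ → S} {s₀ : S}
    (hs : Tendsto s U (𝓝 s₀)) {α ξ : ℕ → ℝ} (hα : ∀ n, α n ∈ Set.Icc (0 : ℝ) 1) {P : ℝ}
    (hP : 0 ≤ P) (hpow : ∀ n, α n * ξ n ^ 2 ≤ P) :
    ∃ a x : ℝ, 0 ≤ a ∧ Tendsto α U (𝓝 a) ∧
      (∃ y : ℕ → ℝ, (∀ n, y n ≤ α n * ξ n ^ 2) ∧ Tendsto y U (𝓝 (a * x ^ 2))) ∧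
      ∀ f : S × ℝ → ℝ, Continuous f → (∀ z, |f z| ≤ 1) →
        Tendsto (fun n => α n * f (s n, ξ n)) U (𝓝 (a * f (s₀, x))) := by
  have hlim : ∀ {l r : ℝ} {β : ℕ → ℝ}, (∀ᶠ n in (U : Filter ℕ), β n ∈ Set.Icc l r) →
      ∃ b ∈ Set.Icc l r, Tendsto β U (𝓝 b) := by
    intro l r β hβ
    exact isCompact_Icc.ultrafilter_le_nhds (U.map β) (le_principal_iff.2 hβ)
  obtain ⟨a, ha, hat⟩ := hlim (Eventually.of_forall hα)
  by_cases hb : ∃ R, ∀ᶠ n in (U : Filter ℕ), |ξ n| ≤ R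
  · obtain ⟨R, hR⟩ := hb
    obtain ⟨x, -, hx⟩ := hlim (hR.mono fun n hn => abs_le.1 hn)
    exact ⟨a, x, ha.1, hat, ⟨_, fun n => le_rfl, hat.mul (hx.pow 2)⟩, fun f hf _ =>
      hat.mul ((hf.tendsto _).comp (hs.prodMk_nhds hx))⟩
  -- Along an ultrafilter, failing to be eventually bounded means eventually exceeding every bound.
  -- With bounded power this forces the weight to tend to zero.
  · push Not at hb
    have ha0 : a = 0 := by
      by_contra hne
      have hpos : 0 < a := lt_of_le_of_ne ha.1 (Ne.symm hne)
      have h1 : a * (P / a + 1) ≤ P := by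
        refine le_of_tendsto (hat.mul_const (P / a + 1)) ?_
        filter_upwards [hb (√(P / a + 1))] with n hn
        have h2 : P / a + 1 ≤ ξ n ^ 2 := by
          rw [← sq_abs]
          exact (Real.sqrt_le_left (abs_nonneg _)).1 hn.le
        exact (mul_le_mul_of_nonneg_left h2 (hα n).1).trans (hpow n)
      have h3 : a * (P / a + 1) = P + a := by field_simp
      linarith
    subst ha0
    -- A weightless atom may be placed anywhere, here at the origin. The escaping point may still
    -- carry power, so only the minorant `0` of its power is passed to the limit, which is enough
    -- for feasibility.
    refine ⟨0, 0, le_rfl, hat, ⟨fun _ => 0, fun n => mul_nonneg (hα n).1 (sq_nonneg _), ?_⟩,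
      fun f hf hf1 => ?_⟩
    · simp
    · rw [zero_mul]
      refine squeeze_zero_norm (fun n => ?_) hat
      rw [norm_mul, Real.norm_of_nonneg (hα n).1]
      exact mul_le_of_le_one_right (hα n).1 (hf1 _)

lemma Feasible.weight_le_one {P : ℝ} {a x : Fin 3 → ℝ} (h : Feasible P a x) (i : Fin 3) :
    a i ≤ 1 := by
  rw [← h.sum_eq]
  exact Finset.single_le_sum (fun j _ => h.nonneg j) (Finset.mem_univ i)

lemma Feasible.term_le {P : ℝ} {a x : Fin 3 → ℝ} (h : Feasible P a x) (i : Fin 3) :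
    a i * x i ^ 2 ≤ P :=
  (Finset.single_le_sum (f := fun j => a j * x j ^ 2)
    (fun j _ => mul_nonneg (h.nonneg j) (sq_nonneg _)) (Finset.mem_univ i)).trans h.power

lemma feasible_zero {P : ℝ} (hP : 0 ≤ P) : Feasible P ![1, 0, 0] ![0, 0, 0] := by
  refine ⟨fun i => ?_, ?_, ?_⟩
  · fin_cases i <;> simp
  · simp [Fin.sum_univ_three]
  · simpa [Fin.sum_univ_three] using hP

/-- Over a compact family of channels, the largest mutual information is attained. -/
lemma exists_isMax_info {S : Type*} [TopologicalSpace S] [CompactSpace S] [Nonempty S]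
    {p : S → ℝ → ℝ} (hp : Continuous fun z : S × ℝ => p z.1 z.2)
    (hp01 : ∀ s x, p s x ∈ Set.Icc (0 : ℝ) 1) {P : ℝ} (hP : 0 ≤ P) :
    ∃ (s₀ : S) (a₀ x₀ : Fin 3 → ℝ), Feasible P a₀ x₀ ∧
      ∀ (s : S) (a x : Fin 3 → ℝ), Feasible P a x → info a (p s ∘ x) ≤ info a₀ (p s₀ ∘ x₀) := by
  set V : Set ℝ := {r | ∃ (s : S) (a x : Fin 3 → ℝ), Feasible P a x ∧ r = info a (p s ∘ x)} with hV
  have hne : V.Nonempty := ⟨_, Classical.arbitrary S, _, _, feasible_zero hP, rfl⟩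
  have hbd : BddAbove V := by
    refine ⟨log 2, ?_⟩
    rintro r ⟨s, a, x, h, rfl⟩
    exact (info_le_binEntropy h.nonneg fun i => hp01 s (x i)).trans Real.binEntropy_le_log_two
  obtain ⟨r, -, hr, hrV⟩ := exists_seq_tendsto_sSup hne hbd
  choose s a x hf hreq using hrV
  -- An ultrafilter finer than `atTop` gives limits of the channel parameter, weights and bounded
  -- points simultaneously, without extracting subsequences.
  set U : Ultrafilter ℕ := hyperfilter ℕ
  have hUtop : (U : Filter ℕ) ≤ atTop := Nat.hyperfilter_le_atTop
  have hs : Tendsto s U (𝓝 (U.map s).lim) := (U.map s).le_nhds_lim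
  set s₀ := (U.map s).lim
  choose a₀ x₀ ha₀ hat hy hF using fun i => exists_limit_point U hs
    (α := fun n => a n i) (ξ := fun n => x n i)
    (fun n => ⟨(hf n).nonneg i, (hf n).weight_le_one i⟩) hP fun n => (hf n).term_le i
  choose y hyle hyt using hy
  have hfeas : Feasible P a₀ x₀ := by
    refine ⟨ha₀, ?_, ?_⟩
    · have h1 : Tendsto (fun n => ∑ i, a n i) U (𝓝 (∑ i, a₀ i)) :=
        tendsto_finsetSum _ fun i _ => hat i
      simp_rw [(hf _).sum_eq] at h1
      exact tendsto_nhds_unique h1 tendsto_const_nhds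
    · have h1 : Tendsto (fun n => ∑ i, y i n) U (𝓝 (∑ i, a₀ i * x₀ i ^ 2)) :=
        tendsto_finsetSum _ fun i _ => hyt i
      exact le_of_tendsto h1 (Eventually.of_forall fun n =>
        (Finset.sum_le_sum fun i _ => hyle i n).trans (hf n).power)
  have hlim : Tendsto (fun n => info (a n) (p (s n) ∘ x n)) U (𝓝 (info a₀ (p s₀ ∘ x₀))) := by
    refine Tendsto.sub ((Real.binEntropy_continuous.tendsto _).comp ?_) ?_
    · exact tendsto_finsetSum _ fun i _ => hF i _ hp fun z => by
        rw [abs_of_nonneg (hp01 _ _).1]; exact (hp01 _ _).2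
    · exact tendsto_finsetSum _ fun i _ => hF i _ (Real.binEntropy_continuous.comp hp)
        fun z => abs_binEntropy_le (hp01 _ _)
  have hmax : info a₀ (p s₀ ∘ x₀) = sSup V := by
    refine tendsto_nhds_unique hlim ?_
    simp_rw [← hreq]
    exact hr.mono_left hUtop
  refine ⟨s₀, a₀, x₀, hfeas, fun s a x h => ?_⟩
  rw [hmax]
  exact le_csSup hbd ⟨s, a, x, h, rfl⟩

end Attainment

/-! ### The best threshold and the capacity. -/

variable {v : ℝ≥0} {P : ℝ}

lemma sq_mul_sum_pr_le {a x : Fin 3 → ℝ} (h : Feasible P a x) {t : ℝ} {E : Set ℝ}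
    (hE : ∀ y ∈ E, t ^ 2 ≤ y ^ 2) : t ^ 2 * ∑ i, a i * pr v E (x i) ≤ P + v := by
  have h1 : t ^ 2 * ∑ i, a i * pr v E (x i) ≤ ∑ i, a i * (x i ^ 2 + v) := by
    rw [Finset.mul_sum]
    refine Finset.sum_le_sum fun i _ => ?_
    have := mul_le_mul_of_nonneg_left (sq_mul_gaussianReal_le (v := v) (x i) t hE) (h.nonneg i)
    unfold pr
    linarith
  simp_rw [mul_add] at h1
  rw [Finset.sum_add_distrib, ← Finset.sum_mul, h.sum_eq, one_mul] at h1
  linarith [h.power]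

/-- Thresholds far from the origin are of little use. -/
lemma exists_info_Ici_lt (v : ℝ≥0) (P : ℝ) {ε : ℝ} (hε : 0 < ε) :
    ∃ T : ℝ, 0 < T ∧ ∀ t : ℝ, T < |t| → ∀ a x : Fin 3 → ℝ, Feasible P a x →
      info a (pr v (Set.Ici t) ∘ x) < ε := by
  have hc : ∀ᶠ q in 𝓝 (0 : ℝ), binEntropy q < ε :=
    (Real.binEntropy_continuous.tendsto 0).eventually_lt_const (by simpa using hε)
  obtain ⟨δ, hδ, hδe⟩ := Metric.eventually_nhds_iff.1 hc
  -- Chebyshev bounds the probability of a region outside `(-|t|, |t|)` by `(P + v) / t ^ 2`. The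
  -- added 1 makes this strictly less than `δ`.
  refine ⟨√(|P + v| / δ + 1), by positivity, fun t ht a x h => ?_⟩
  have ht2 : |P + v| / δ + 1 < t ^ 2 := by
    rw [← sq_abs]
    exact (Real.sqrt_lt' ((Real.sqrt_nonneg _).trans_lt ht)).1 ht
  have key : ∀ E : Set ℝ, (∀ y ∈ E, t ^ 2 ≤ y ^ 2) →
      info a (pr v E ∘ x) < ε := by
    intro E hE
    have h1 := sq_mul_sum_pr_le (v := v) h hE
    have h0 : 0 ≤ ∑ i, a i * pr v E (x i) :=
      Finset.sum_nonneg fun i _ => mul_nonneg (h.nonneg i) (pr_mem_Icc _).1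
    refine (info_le_binEntropy h.nonneg fun i => pr_mem_Icc (x i)).trans_lt (hδe ?_)
    rw [Real.dist_eq, sub_zero]
    rw [abs_of_nonneg h0]
    by_contra! hge
    have h2 : (|P + v| / δ + 1) * δ ≤ t ^ 2 * ∑ i, a i * pr v E (x i) :=
      mul_le_mul ht2.le hge hδ.le (sq_nonneg t)
    have h3 : (|P + v| / δ + 1) * δ = |P + v| + δ := by field_simp
    linarith [le_abs_self (P + v)]
  rcases le_total 0 t with h0 | h0
  · refine key _ fun y hy => ?_
    have : t ≤ y := hy
    nlinarith
  -- For negative `t` it is the complementary ray that lies far from the origin, and it carries the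
  -- same information.
  · rw [← info_pr_compl h measurableSet_Ici]
    refine key _ fun y hy => ?_
    have : y < t := by simpa using hy
    nlinarith

lemma pr_Ici_zero_lt (hv : v ≠ 0) {s : ℝ} (hs : 0 < s) :
    pr v (Set.Ici 0) (-s) < pr v (Set.Ici 0) s := by
  have h1 : pr v (Set.Ici 0) s = pr v (Set.Ici (-s)) 0 := by rw [pr_translate (-s)]; simp
  have h2 : pr v (Set.Ici 0) (-s) = pr v (Set.Ici s) 0 := by rw [pr_translate s]; simp
  have hsub : Set.Ici s ⊆ Set.Ici (-s) := Set.Ici_subset_Ici.2 (by linarith)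
  have h3 := measureReal_sdiff (μ := gaussianReal 0 v) hsub measurableSet_Ici
  have h4 : 0 < (gaussianReal 0 v).real (Set.Ici (-s) \ Set.Ici s) := by
    refine ENNReal.toReal_pos (fun h => ?_) (measure_ne_top _ _)
    have h5 := gaussianReal_absolutelyContinuous' 0 hv h
    rw [Set.Ici_sdiff_Ici, Real.volume_Ico, ENNReal.ofReal_eq_zero] at h5
    linarith
  rw [h1, h2]
  unfold pr
  linarith

/-- Equiprobable inputs at `√P` and `-√P` give different conditional probabilities under the
threshold 0, so strict concavity of the entropy makes the information positive. -/
lemma exists_info_pos (hv : v ≠ 0) (hP : 0 < P) :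
    ∃ a x : Fin 3 → ℝ, Feasible P a x ∧ 0 < info a (pr v (Set.Ici 0) ∘ x) := by
  have hfeas : Feasible P ![1 / 2, 1 / 2] ![√P, -√P] := by
    refine ⟨fun i => ?_, ?_, ?_⟩
    · fin_cases i <;> simp
    · simp [Fin.sum_univ_two]; norm_num
    · simp [Fin.sum_univ_two, Real.sq_sqrt hP.le]; linarith
  obtain ⟨a, x, h, hle⟩ := hfeas.exists_three (pr v (Set.Ici 0))
  refine ⟨a, x, h, lt_of_lt_of_le ?_ hle⟩
  have hne := pr_Ici_zero_lt hv (Real.sqrt_pos.2 hP)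
  have hc := Real.strictConcave_binEntropy.2 (pr_mem_Icc (v := v) (D := Set.Ici 0) (-√P))
    (pr_mem_Icc (√P)) hne.ne (by norm_num : (0 : ℝ) < 1 / 2) (by norm_num : (0 : ℝ) < 1 / 2)
    (by norm_num)
  simp only [smul_eq_mul] at hc
  simp only [info, Fin.sum_univ_two, Function.comp_apply, Matrix.cons_val_zero,
    Matrix.cons_val_one]
  rw [add_comm (1 / 2 * pr v (Set.Ici 0) √P)]
  linarith

/-- Among the threshold regions and the inputs with at most three points there is a best choice. -/
lemma exists_best_threshold (hv : v ≠ 0) (hP : 0 < P) :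
    ∃ (t₀ : ℝ) (a₀ x₀ : Fin 3 → ℝ), Feasible P a₀ x₀ ∧
      0 < info a₀ (pr v (Set.Ici t₀) ∘ x₀) ∧
      ∀ (t : ℝ) (a x : Fin 3 → ℝ), Feasible P a x →
        info a (pr v (Set.Ici t) ∘ x) ≤ info a₀ (pr v (Set.Ici t₀) ∘ x₀) := by
  obtain ⟨a₁, x₁, h₁, hpos⟩ := exists_info_pos hv hP
  -- The cutoff is chosen against a value reached by the threshold 0, so thresholds outside `[-T,
  -- T]` cannot win and the search is compact.
  obtain ⟨T, hT, hfar⟩ := exists_info_Ici_lt v P hpos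
  have h0mem : (0 : ℝ) ∈ Set.Icc (-T) T := ⟨by linarith, hT.le⟩
  have hne : Nonempty (Set.Icc (-T) T) := ⟨⟨0, h0mem⟩⟩
  have hcont : Continuous fun z : Set.Icc (-T) T × ℝ => pr v (Set.Ici (z.1 : ℝ)) z.2 :=
    continuous_pr_Ici hv continuous_subtype_val
  obtain ⟨s₀, a₀, x₀, h₀, hmax⟩ := exists_isMax_info
    (p := fun (s : Set.Icc (-T) T) => pr v (Set.Ici (s : ℝ))) hcont (fun s x => pr_mem_Icc x) hP.le
  have hzero := hmax ⟨0, h0mem⟩ a₁ x₁ h₁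
  refine ⟨s₀, a₀, x₀, h₀, hpos.trans_le hzero, fun t a x h => ?_⟩
  rcases le_or_gt |t| T with ht | ht
  · exact hmax ⟨t, abs_le.1 ht⟩ a x h
  · exact (hfar t ht a x h).le.trans hzero

/-- For a given region, some input with at most three points achieves the capacity. -/
lemma exists_capacityOfRegion_eq (hv : v ≠ 0) (hP : 0 < P) {D : Set ℝ} (hD : MeasurableSet D) :
    ∃ a x : Fin 3 → ℝ, Feasible P a x ∧
      capacityOfRegion P v D = ENNReal.ofReal (info a (pr v D ∘ x)) := by
  obtain ⟨-, a, x, h, hmax⟩ := exists_isMax_info (S := Unit) (p := fun _ => pr v D)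
    ((continuous_pr hv D).comp continuous_snd) (fun _ x => pr_mem_Icc x) hP.le
  exact ⟨a, x, h, le_antisymm (capacityOfRegion_le hv hD hP.le fun b y hb => hmax () b y hb)
    (ofReal_info_le_capacityOfRegion hv hD h)⟩

lemma exists_threshold_isCapacityAchieving (hv : v ≠ 0) (hP : 0 < P) :
    ∃ t₀ : ℝ, IsCapacityAchieving P v {y | t₀ ≤ y} ∧
      ∀ D : Set ℝ, IsCapacityAchieving P v D → IsThreshold D := by
  obtain ⟨t₀, a₀, x₀, h₀, hpos, hmax⟩ := exists_best_threshold hv hP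
  set M := info a₀ (pr v (Set.Ici t₀) ∘ x₀) with hM
  have hbound : ∀ D : Set ℝ, MeasurableSet D → ∀ a x : Fin 3 → ℝ, Feasible P a x →
      info a (pr v D ∘ x) ≤ M ∧ (info a (pr v D ∘ x) = M → IsThreshold D) := by
    intro D hD a x h
    rcases le_or_gt (info a (pr v D ∘ x)) 0 with hle | hlt
    · exact ⟨hle.trans hpos.le, fun he => absurd he (hle.trans_lt hpos).ne⟩
    rcases isThreshold_or_exists_info_gt hv hD h hlt with ht | ⟨t, b, y, hb, hgt⟩
    · obtain ⟨t, hteq⟩ := ht.exists_info_eq hv hD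
      exact ⟨hteq P a x h ▸ hmax t a x h, fun _ => ht⟩
    · have := hgt.trans_le (hmax t b y hb)
      exact ⟨this.le, fun he => absurd he this.ne⟩
  have hge : ENNReal.ofReal M ≤ capacityOfRegion P v (Set.Ici t₀) :=
    ofReal_info_le_capacityOfRegion hv measurableSet_Ici h₀
  have hcap : capacity P v = ENNReal.ofReal M := by
    refine le_antisymm (iSup₂_le fun D hD => ?_) (hge.trans ?_)
    · exact capacityOfRegion_le hv hD hP.le fun a x h => (hbound D hD a x h).1
    · exact le_iSup₂ (f := fun (D : Set ℝ) (_ : MeasurableSet D) => capacityOfRegion P v D)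
        (Set.Ici t₀) measurableSet_Ici
  refine ⟨t₀, ⟨measurableSet_Ici, le_antisymm ?_ (hcap ▸ hge)⟩, fun D hD => ?_⟩
  · exact le_iSup₂ (f := fun (D : Set ℝ) (_ : MeasurableSet D) => capacityOfRegion P v D)
      (Set.Ici t₀) measurableSet_Ici
  -- Attainment for the region `D` itself is essential here: equality of suprema becomes equality of
  -- information with `M` at an actual input, and the strict improvement then excludes other shapes.
  · obtain ⟨a, x, h, heq⟩ := exists_capacityOfRegion_eq hv hP hD.1
    refine (hbound D hD.1 a x h).2 (le_antisymm (hbound D hD.1 a x h).1 ?_)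
    have h1 : ENNReal.ofReal M ≤ ENNReal.ofReal (info a (pr v D ∘ x)) := by
      rw [← hcap, ← heq, hD.2]
    by_contra! hlt
    exact absurd h1 (not_le.2 ((ENNReal.ofReal_lt_ofReal_iff hpos).2 hlt))

end OneBit

theorem proposition2 :
    ∃ Υ : ℝ → ℝ≥0 → ℝ, ∀ (P : ℝ) (v : ℝ≥0), 0 < P → 0 < v →
      OneBit.IsCapacityAchieving P v {y : ℝ | Υ P v ≤ y} ∧
      ∀ D : Set ℝ, OneBit.IsCapacityAchieving P v D →
        ∃ t : ℝ, volume (D ∆ {y : ℝ | t ≤ y}) = 0 ∨ volume (Dᶜ ∆ {y : ℝ | t ≤ y}) = 0 := by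
  have h : ∀ (P : ℝ) (v : ℝ≥0), ∃ t₀ : ℝ, 0 < P → 0 < v →
      OneBit.IsCapacityAchieving P v {y | t₀ ≤ y} ∧
        ∀ D : Set ℝ, OneBit.IsCapacityAchieving P v D → OneBit.IsThreshold D := by
    intro P v
    by_cases hc : 0 < P ∧ 0 < v
    · obtain ⟨t₀, ht₀⟩ := OneBit.exists_threshold_isCapacityAchieving hc.2.ne' hc.1
      exact ⟨t₀, fun _ _ => ht₀⟩
    -- An arbitrary value for parameters outside the range of the theorem, so that `Υ` can be chosen
    -- as a total function.
    · exact ⟨0, fun hP hv => absurd ⟨hP, hv⟩ hc⟩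
  choose Υ hΥ using h
  refine ⟨Υ, fun P v hP hv => ⟨(hΥ P v hP hv).1, fun D hD => ?_⟩⟩
  obtain ⟨t, ht⟩ := (hΥ P v hP hv).2 D hD
  exact ⟨t, ht.imp measure_symmDiff_eq_zero_iff.2 measure_symmDiff_eq_zero_iff.2⟩
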